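/- Let $\mathbb{k}$ be any field, $S=\mathbb{k}[x,y,z,w]$ and $$I=\langle x^2,\;xy,\;y^2z^2,\;zw,\;w^2\rangle\subseteq S,$$ a monomial ideal with these five monomials as its minimal monomial generators. The standard $\mathbb{Z}$-grading of $S$ is the one in which every variable has degree $1$. If $X$ is a polyhedral cell complex (for instance a simplicial complex), the empty cell included, whose vertices are labelled by generators of $I$, its *cellular free complex* over $S$ has one basis element $g_W$ for each cell $W$, in homological degree $\dim W+1$ and of multidegree (the exponent of) $m_W$, the least common multiple of the labels of the vertices of $W$. Its differential is $\partial g_W=\sum_U \varepsilon(W,U)\,\frac{m_W}{m_U}\,g_U$, the sum over the facets $U$ of $W$, where $\varepsilon$ is an incidence function of $X$ (signs $\pm1$ with $\varepsilon(\{v\},\emptyset)=1$ and $\partial^2=0$). The part $\mathbb{F}_0$ of homological degree $0$ is identified with $S$ through $g_\emptyset\mapsto 1$. The total degree of $g_W$ is the degree of $m_W$. A *DGA structure* on such a complex $\mathbb{F}$ is an $S$-linear map $*:\mathbb{F}\otimes_S\mathbb{F}\to\mathbb{F}$ which extends the multiplication of $\mathbb{F}_0=S$ and satisfies, for all homologically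 homogeneous $a,b,c$, the Leibniz rule $\partial(a*b)=\partial a*b+(-1)^{|a|}a*\partial b$, $|a*b|=|a|+|b|$, $a*b=(-1)^{|a||b|}\,b*a$ and $(a*b)*c=a*(b*c)$. Then: 1. The hull resolution of $S/I$ does not admit a DGA structure whose multiplication respects the standard $\mathbb{Z}$-grading. Here the hull resolution is the cellular free complex of the hull complex of $I$: for $t>5!$ this is the complex of bounded faces of the polyhedron $P_t=\operatorname{conv}\{(t^{a_1},\dots,t^{a_4}) : x^{a_1}y^{a_2}z^{a_3}w^{a_4}\in I\}\subseteq\mathbb{R}^4$, the vertex $(t^{a_1},\dots,t^{a_4})$ being labelled by $x^{a_1}y^{a_2}z^{a_3}w^{a_4}$. The claim holds for every $t>5!$ and every incidence function (and incidence functions exist). 2. The Lyubeznik resolution of $S/I$ with respect to the order $xy\prec zw\prec x^2\prec y^2z^2\prec w^2$ of the generators does not admit a DGA structure whose multiplication respects the standard $\mathbb{Z}$-grading. Here the Lyubeznik resolution is the cellular free complex of the simplicial complex of all sets $W$ of generators such that, for every $m\in W$, no generator $q\prec m$ divides $\operatorname{lcm}\{m'\in W : m\preceq m'\}$. 3. The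 minimal free resolution of $S/I$ is supported on a simplicial complex, that is, it is the cellular free complex of a simplicial complex whose vertices are the five generators of $I$ (labelled by themselves); and it does not admit a DGA structure whose multiplication respects the standard $\mathbb{Z}$-grading. In particular, none of the three resolutions admits a DGA structure whose multiplication respects the $\mathbb{Z}^4$-grading. -/

import Mathlib

open scoped Classical in
/-- The combinatorial data of a labelled polyhedral cell complex with vertices in `V` which
determine its cellular free complex over a polynomial ring in the variables `σ`. A cell is recorded by its finite set of
vertices; the empty cell is included. `rank W` is `dim W + 1`, `label v` is the exponent vector of
the monomial which labels the vertex `v`, and `sign` is an incidence function: `sign W U` is `1` or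
`-1` if `U` is a facet of `W` and `0` otherwise, `sign {v} ∅ = 1`, and the signs on the two paths
from a cell to a face of codimension two cancel. -/
structure LabelledCellComplex (σ V : Type*) where
  cells : Set (Finset V)
  rank : Finset V → ℕ
  label : V → σ →₀ ℕ
  sign : Finset V → Finset V → ℤ
  empty_mem : ∅ ∈ cells
  rank_eq_zero_iff : ∀ W ∈ cells, rank W = 0 ↔ W = ∅
  sign_of_facet : ∀ W ∈ cells, ∀ U ∈ cells, U ⊆ W → rank W = rank U + 1 →
    sign W U = 1 ∨ sign W U = -1
  sign_of_not_facet : ∀ W ∈ cells, ∀ U ∈ cells, ¬ (U ⊆ W ∧ rank W = rank U + 1) → sign W U = 0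
  sign_vertex : ∀ W ∈ cells, rank W = 1 → sign W ∅ = 1
  sign_comp : ∀ W ∈ cells, ∀ T ∈ cells,
    ∑ U ∈ W.powerset with U ∈ cells, sign W U * sign U T = 0

namespace LabelledCellComplex

variable {σ V : Type*} (X : LabelledCellComplex σ V) (k : Type*) [Field k]

/-- The multidegree of the cell `W`: the exponent of the lcm of the labels of its vertices. -/
noncomputable def mdeg (W : Finset V) : σ →₀ ℕ := W.sup X.label

/-- The free module over the polynomial ring with one basis element `g_W` for each cell `W`. -/
abbrev FreeModule : Type _ := X.cells →₀ MvPolynomial σ k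

/-- The differential of the cellular free complex:
`∂ g_W = ∑ U, sign W U • (m_W / m_U) • g_U`, where `m_W = x ^ mdeg W`. -/
noncomputable def d : X.FreeModule k →ₗ[MvPolynomial σ k] X.FreeModule k :=
  open scoped Classical in
  Finsupp.linearCombination (MvPolynomial σ k) fun W : X.cells =>
    ∑ U ∈ W.1.powerset.subtype (· ∈ X.cells),
      Finsupp.single U (MvPolynomial.monomial (X.mdeg W - X.mdeg U) (X.sign W U : k))

/-- The part of homological degree `i`; `g_W` has homological degree `rank W = dim W + 1`. -/
noncomputable def hpart (i : ℕ) : Submodule (MvPolynomial σ k) (X.FreeModule k) :=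
  Finsupp.supported _ _ {W : X.cells | X.rank W = i}

/-- `s ↦ s • g_∅`, the identification of the polynomial ring with the part of homological
degree `0`. -/
noncomputable def unit (s : MvPolynomial σ k) : X.FreeModule k :=
  Finsupp.single ⟨∅, X.empty_mem⟩ s

variable {k}

/-- `f` is homogeneous of total degree `n` for the standard `ℤ`-grading: every term `x ^ e • g_W`
of `f` satisfies `|e| + |mdeg W| = n`. -/
def IsHomogeneousOfDegree (f : X.FreeModule k) (n : ℕ) : Prop :=
  ∀ (W : X.cells) (e : σ →₀ ℕ), (f W).coeff e ≠ 0 → e.degree + (X.mdeg W).degree = n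

/-- A differential graded algebra structure on the cellular free complex of `X`. The bilinear map
`mul` is a linear map out of the tensor square. -/
structure IsDGAStructure
    (mul : X.FreeModule k →ₗ[MvPolynomial σ k] X.FreeModule k →ₗ[MvPolynomial σ k]
      X.FreeModule k) : Prop where
  mul_unit : ∀ s t, mul (X.unit k s) (X.unit k t) = X.unit k (s * t)
  leibniz : ∀ i, ∀ a ∈ X.hpart k i, ∀ b,
    X.d k (mul a b) = mul (X.d k a) b + (-1 : ℤ) ^ i • mul a (X.d k b)
  mul_mem : ∀ i j, ∀ a ∈ X.hpart k i, ∀ b ∈ X.hpart k j, mul a b ∈ X.hpart k (i + j)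
  comm : ∀ i j, ∀ a ∈ X.hpart k i, ∀ b ∈ X.hpart k j,
    mul a b = (-1 : ℤ) ^ (i * j) • mul b a
  assoc : ∀ a b c, mul (mul a b) c = mul a (mul b c)

variable (k)

/-- The cellular free complex of `X` over `k` admits a DGA structure whose multiplication respects
the standard `ℤ`-grading. -/
def AdmitsDGAStructure : Prop :=
  ∃ mul : X.FreeModule k →ₗ[MvPolynomial σ k] X.FreeModule k →ₗ[MvPolynomial σ k]
      X.FreeModule k,
    X.IsDGAStructure mul ∧
    ∀ (a b : X.FreeModule k) (p q : ℕ), X.IsHomogeneousOfDegree a p →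
      X.IsHomogeneousOfDegree b q → X.IsHomogeneousOfDegree (mul a b) (p + q)

variable {k}

/-- The cellular free complex of `X` is a minimal free resolution of `S / I`. (Its part of
homological degree `0` is the polynomial ring `S`, embedded by `unit`.) -/
structure IsMinimalFreeResolution (I : Ideal (MvPolynomial σ k)) : Prop where
  exact : ∀ i, ∀ f ∈ X.hpart k (i + 1), X.d k f = 0 ↔ ∃ g ∈ X.hpart k (i + 2), X.d k g = f
  coker : ∀ s, (∃ g ∈ X.hpart k 1, X.d k g = X.unit k s) ↔ s ∈ I
  minimal : ∀ f W, X.d k f W ∈ MvPolynomial.idealOfVars σ k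

end LabelledCellComplex

section Simplicial

variable {V : Type*} [LinearOrder V]

/-- `(-1) ^ #{v' ∈ W | v' < v}` if `U = W \ {v}` for some `v ∈ W`, and `0` otherwise. -/
def simplexSign (W U : Finset V) : ℤ :=
  if U ⊆ W ∧ W.card = U.card + 1 then ∏ v ∈ W \ U, (-1) ^ (W.filter (· < v)).card else 0

theorem simplexSign_erase {W : Finset V} {v : V} (hv : v ∈ W) :
    simplexSign W (W.erase v) = (-1) ^ (W.filter (· < v)).card := by
  have h1 : W.card = (W.erase v).card + 1 := (Finset.card_erase_add_one hv).symm
  have h2 : W \ W.erase v = {v} := Finset.sdiff_erase_self hv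
  rw [simplexSign, if_pos ⟨Finset.erase_subset _ _, h1⟩, h2, Finset.prod_singleton]

theorem exists_erase {W U : Finset V} (h : U ⊆ W) (hc : W.card = U.card + 1) :
    ∃ v ∈ W, U = W.erase v := by
  have h1 : (W \ U).card = 1 := by rw [Finset.card_sdiff_of_subset h]; omega
  obtain ⟨v, hv⟩ := Finset.card_eq_one.1 h1
  have hvW : v ∈ W \ U := by rw [hv]; exact Finset.mem_singleton_self v
  refine ⟨v, (Finset.mem_sdiff.1 hvW).1, ?_⟩
  rw [Finset.erase_eq, ← hv, Finset.sdiff_sdiff_eq_self h]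

theorem simplexSign_erase_erase {W : Finset V} {a b : V} (ha : a ∈ W) (hb : b ∈ W) (hab : a < b) :
    simplexSign W (W.erase a) * simplexSign (W.erase a) ((W.erase a).erase b) +
      simplexSign W (W.erase b) * simplexSign (W.erase b) ((W.erase a).erase b) = 0 := by
  have hb' : b ∈ W.erase a := Finset.mem_erase.2 ⟨hab.ne', hb⟩
  have ha' : a ∈ W.erase b := Finset.mem_erase.2 ⟨hab.ne, ha⟩
  rw [simplexSign_erase ha, simplexSign_erase hb', Finset.erase_right_comm,
    simplexSign_erase hb, simplexSign_erase ha']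
  have h1 : (W.erase b).filter (· < a) = W.filter (· < a) := by
    ext x; simp only [Finset.mem_filter, Finset.mem_erase]
    exact ⟨fun h => ⟨h.1.2, h.2⟩, fun h => ⟨⟨(h.2.trans hab).ne, h.1⟩, h.2⟩⟩
  have h2 : (W.filter (· < b)).card = ((W.erase a).filter (· < b)).card + 1 := by
    rw [Finset.filter_erase, Finset.card_erase_add_one (Finset.mem_filter.2 ⟨ha, hab⟩)]
  rw [h1, h2]
  ring

theorem simplexSign_comp (cells : Set (Finset V)) [DecidablePred (· ∈ cells)]
    (hc : ∀ W ∈ cells, ∀ U ⊆ W, U ∈ cells) (W : Finset V) (hW : W ∈ cells) (T : Finset V) :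
    ∑ U ∈ W.powerset with U ∈ cells, simplexSign W U * simplexSign U T = 0 := by
  by_cases h : ∃ U, simplexSign W U * simplexSign U T ≠ 0
  · obtain ⟨U, hU⟩ := h
    have hWU : U ⊆ W ∧ W.card = U.card + 1 := by
      by_contra hn; exact hU (by simp [simplexSign, hn])
    have hUT : T ⊆ U ∧ U.card = T.card + 1 := by
      by_contra hn; exact hU (by simp [simplexSign, hn])
    obtain ⟨a, ha, rfl⟩ := exists_erase hWU.1 hWU.2
    obtain ⟨b, hb, rfl⟩ := exists_erase hUT.1 hUT.2
    have hbW := Finset.mem_of_mem_erase hb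
    have hne : b ≠ a := (Finset.mem_erase.1 hb).1
    have hsum : ∑ U ∈ W.powerset with U ∈ cells,
        simplexSign W U * simplexSign U ((W.erase a).erase b) =
        ∑ U ∈ {W.erase a, W.erase b},
          simplexSign W U * simplexSign U ((W.erase a).erase b) := by
      symm
      refine Finset.sum_subset ?_ ?_
      · intro U hU
        have : U ⊆ W := by
          rcases Finset.mem_insert.1 hU with rfl | hU
          · exact Finset.erase_subset _ _
          · rw [Finset.mem_singleton.1 hU]; exact Finset.erase_subset _ _
        exact Finset.mem_filter.2 ⟨Finset.mem_powerset.2 this, hc W hW U this⟩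
      · intro U _ hU
        by_contra hne0
        have hWU' : U ⊆ W ∧ W.card = U.card + 1 := by
          by_contra hn; exact hne0 (by simp [simplexSign, hn])
        have hUT' : (W.erase a).erase b ⊆ U := by
          by_contra hn; exact hne0 (by simp [simplexSign, hn])
        obtain ⟨c, hcW, rfl⟩ := exists_erase hWU'.1 hWU'.2
        apply hU
        by_cases hca : c = a
        · simp [hca]
        · by_cases hcb : c = b
          · simp [hcb]
          · exact absurd (hUT' (Finset.mem_erase.2 ⟨hcb, Finset.mem_erase.2 ⟨hca, hcW⟩⟩))
              (Finset.notMem_erase c W)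
    have hpair : W.erase a ≠ W.erase b := fun heq =>
      Finset.notMem_erase b W (heq ▸ Finset.mem_erase.2 ⟨hne, hbW⟩)
    rw [hsum, Finset.sum_pair hpair]
    rcases lt_or_gt_of_ne hne with hlt | hlt
    · have := simplexSign_erase_erase hbW ha hlt
      rw [Finset.erase_right_comm] at this
      rw [add_comm]; exact this
    · exact simplexSign_erase_erase ha hbW hlt
  · push Not at h
    exact Finset.sum_eq_zero fun U _ => h U

/-- The simplicial complex `Δ` as a labelled cell complex. Its cellular free complex is the
subcomplex of the Taylor resolution spanned by the `g_W` with `W` empty or a face of `Δ`. -/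
def PreAbstractSimplicialComplex.toLabelledCellComplex {σ : Type*}
    (Δ : PreAbstractSimplicialComplex V) (label : V → σ →₀ ℕ) : LabelledCellComplex σ V where
  cells := {W | W = ∅ ∨ W ∈ Δ.faces}
  rank := Finset.card
  label := label
  sign := simplexSign
  empty_mem := Or.inl rfl
  rank_eq_zero_iff _ _ := Finset.card_eq_zero
  sign_of_facet W _ U _ h1 h2 := by
    obtain ⟨v, hv, rfl⟩ := exists_erase h1 h2
    rw [simplexSign_erase hv]
    exact neg_one_pow_eq_or ℤ _
  sign_of_not_facet W _ U _ h := if_neg h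
  sign_vertex W _ h := by
    obtain ⟨v, rfl⟩ := Finset.card_eq_one.1 h
    have h0 : ({v} : Finset V).filter (· < v) = ∅ := by
      ext x
      simp only [Finset.mem_filter, Finset.mem_singleton, Finset.notMem_empty, iff_false]
      rintro ⟨rfl, hx⟩
      exact lt_irrefl _ hx
    have := simplexSign_erase (Finset.mem_singleton_self v)
    rwa [h0, Finset.erase_singleton, Finset.card_empty, pow_zero] at this
  sign_comp W hW T _ := by
    classical
    convert simplexSign_comp {W | W = ∅ ∨ W ∈ Δ.faces} ?_ W hW T
    rintro W (rfl | hW) U hU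
    · exact Or.inl (Finset.subset_empty.1 hU)
    · rcases U.eq_empty_or_nonempty with h | h
      · exact Or.inl h
      · exact Or.inr ((Δ.isRelLowerSet_faces hW).2 hU h)

/-- The Lyubeznik simplicial complex of the monomials `x ^ m v`, ordered by the linear order of `V`:
a nonempty `W` is a face iff for every `i ∈ W` no monomial `x ^ m q` with `q < i` divides the lcm of
the monomials `x ^ m j`, `j ∈ W`, `i ≤ j`. -/
noncomputable def lyubeznikComplex {σ : Type*} (m : V → σ →₀ ℕ) :
    PreAbstractSimplicialComplex V where
  faces := {W | W.Nonempty ∧ ∀ i ∈ W, ∀ q < i, ¬ m q ≤ (W.filter (i ≤ ·)).sup m}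
  isRelLowerSet_faces := by
    rintro W ⟨hW, h⟩
    refine ⟨hW, fun U hU hne => ⟨hne, fun i hi q hq hle => h i (hU hi) q hq (hle.trans ?_)⟩⟩
    exact Finset.sup_mono (Finset.filter_subset_filter _ hU)

end Simplicial

section Monomial

variable {σ : Type*} {k : Type*} [Field k]

/-- `I` is generated by monomials. -/
def IsMonomialIdeal (I : Ideal (MvPolynomial σ k)) : Prop :=
  ∃ A : Set (σ →₀ ℕ), I = Ideal.span ((fun a => MvPolynomial.monomial a (1 : k)) '' A)

/-- The monomials `x ^ m v`, `v : V`, are the minimal monomial generators of `I`, listed without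
repetition. -/
def ListsMinimalGenerators {V : Type*} (I : Ideal (MvPolynomial σ k)) (m : V → σ →₀ ℕ) : Prop :=
  Function.Injective m ∧
    Set.range m = {a | Minimal (fun b => MvPolynomial.monomial b (1 : k) ∈ I) a}

/-- The point `t ^ a = (t ^ a₁, …, t ^ aₙ)` of `ℝⁿ`. -/
def powPoint (t : ℝ) (a : σ →₀ ℕ) : σ → ℝ := fun i => t ^ a i

/-- The polyhedron `P_t`, the convex hull of the points `t ^ a` with `x ^ a ∈ I`. -/
def hullPolyhedron (I : Ideal (MvPolynomial σ k)) (t : ℝ) : Set (σ → ℝ) :=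
  convexHull ℝ (powPoint t '' {a | MvPolynomial.monomial a (1 : k) ∈ I})

/-- `X` is the hull complex of `I`, computed with the parameter `t`: its nonempty cells are the
bounded nonempty faces of the polyhedron `P_t`. A face is recorded by its vertices; the vertices of
`P_t` are the points `t ^ m v`, where the `x ^ m v` are the minimal generators of `I`, and
the vertex `t ^ m v` is labelled by `x ^ m v`. -/
structure LabelledCellComplex.IsHullComplex [Fintype σ] {V : Type*} (X : LabelledCellComplex σ V)
    (I : Ideal (MvPolynomial σ k)) (m : V → σ →₀ ℕ) (t : ℝ) : Prop where
  lists : ListsMinimalGenerators I m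
  label_eq : X.label = m
  mem_cells_iff : ∀ W, W ∈ X.cells ↔ W = ∅ ∨ ∃ F : Set (σ → ℝ),
    IsExposed ℝ (hullPolyhedron I t) F ∧ F.Nonempty ∧ Bornology.IsBounded F ∧
      ∀ v, v ∈ W ↔ powPoint t (m v) ∈ F
  rank_eq : ∀ W ∈ X.cells, W ≠ ∅ →
    X.rank W = Module.finrank ℝ (vectorSpan ℝ ((fun v => powPoint t (m v)) '' (W : Set V))) + 1

end Monomial

/-! All three complexes are the Scarf complex of I. Number xy, zw, x², y²z², w² as 0, …, 4. The
faces are the sets containing neither {2,3} nor {3,4}, because xy divides lcm(x², y²z²) and zw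
divides lcm(y²z², w²); the facets are {0,1,2,4} and {0,1,3}. Below each multidegree the complex is
empty or a cone, which gives a contracting homotopy and exactness. Deleting a vertex of a face
changes the lcm, which gives minimality (`IsScarf.isMinimalFreeResolution`). The incidence function
stays arbitrary throughout, as the claim on the hull resolution requires.

The obstruction (`IsScarf.not_isGradedDGA`) is the associativity of g_2 * g_3 * g_4. In low total
degree the next module of the resolution vanishes, so a ℤ-graded product is forced to be ℤ⁴-graded
(`mem_gpart_of_d_mem`); this determines products of quadric vertices up to nonzero scalars. Put A =
g_2 * g_3 and C = g_3 * g_4, and compare the coefficients of g_024 in A * g_4 and g_2 * C modulo ⟨x,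
w⟩. The boundaries ∂A = x² g_3 − y²z² g_2 and ∂C = y²z² g_4 − w² g_3 force the coefficients of A and
C at {0,3} and {1,3} into ⟨x, w⟩. Among the other edges only {0,2} contributes to A * g_4, by a
nonzero scalar times the coefficient A_02, and none contributes to g_2 * C. Hence A_02 lies in ⟨x,
w⟩. But modulo ⟨x, w⟩ the coefficient of g_2 in ∂A is ± y A_02, and it equals −y²z²: a
contradiction. -/

namespace LabelledCellComplex

/-! ### Multigraded pieces of a cellular free complex. -/

variable {σ V : Type*} (X : LabelledCellComplex σ V) (k : Type*) [Field k]

/-- The cells of `X` form a simplicial complex. -/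
structure IsSimplicial : Prop where
  rank_eq : ∀ W ∈ X.cells, X.rank W = W.card
  subset_mem : ∀ W ∈ X.cells, ∀ U ⊆ W, U ∈ X.cells

open scoped Classical in
/-- The element `c • x ^ (α - mdeg W) • g_W`, of multidegree `α` if `mdeg W ≤ α`; it is `0` if `W`
is not a cell. -/
noncomputable def term (α : σ →₀ ℕ) (W : Finset V) : k →ₗ[k] X.FreeModule k :=
  if h : W ∈ X.cells then
    (Finsupp.lsingle ⟨W, h⟩ : MvPolynomial σ k →ₗ[k] X.FreeModule k) ∘ₗ
      MvPolynomial.monomial (α - X.mdeg W)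
  else 0

variable {X k}

theorem term_of_mem {α : σ →₀ ℕ} {W : Finset V} (h : W ∈ X.cells) (c : k) :
    X.term k α W c = Finsupp.single ⟨W, h⟩ (MvPolynomial.monomial (α - X.mdeg W) c) := by
  simp [term, h]

theorem term_of_notMem {α : σ →₀ ℕ} {W : Finset V} (h : W ∉ X.cells) (c : k) :
    X.term k α W c = 0 := by
  simp [term, h]

theorem single_monomial_eq_term (W : X.cells) (e : σ →₀ ℕ) (c : k) :
    (Finsupp.single W (MvPolynomial.monomial e c) : X.FreeModule k) =
      X.term k (e + X.mdeg W) W c := by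
  rw [term_of_mem W.2, add_tsub_cancel_right]

theorem monomial_smul_term {α : σ →₀ ℕ} {W : Finset V} (hα : X.mdeg W ≤ α) (e : σ →₀ ℕ)
    (b c : k) :
    MvPolynomial.monomial e b • X.term k α W c = X.term k (e + α) W (b * c) := by
  by_cases h : W ∈ X.cells
  · rw [term_of_mem h, term_of_mem h, Finsupp.smul_single, smul_eq_mul,
      MvPolynomial.monomial_mul, add_tsub_assoc_of_le hα]
  · rw [term_of_notMem h, term_of_notMem h, smul_zero]

theorem mdeg_mono {U W : Finset V} (h : U ⊆ W) : X.mdeg U ≤ X.mdeg W :=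
  Finset.sup_mono h

/-- Indexing a term by its multidegree α absorbs the quotients m_W / m_U: on terms, ∂ is the plain
boundary of the cell complex. Subsets that are not cells contribute 0. -/
theorem d_term {α : σ →₀ ℕ} {W : Finset V} (hW : W ∈ X.cells) (hα : X.mdeg W ≤ α) (c : k) :
    X.d k (X.term k α W c) = ∑ U ∈ W.powerset, X.term k α U (c * X.sign W U) := by
  classical
  rw [term_of_mem hW, d, Finsupp.linearCombination_single]
  have h1 : ∀ U ∈ W.powerset.subtype (· ∈ X.cells),
      MvPolynomial.monomial (α - X.mdeg W) c • (Finsupp.single U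
        (MvPolynomial.monomial (X.mdeg W - X.mdeg U) (X.sign W U : k)) : X.FreeModule k) =
      X.term k α U (c * X.sign W U) := by
    intro U hU
    have hUW : U.1 ⊆ W := Finset.mem_powerset.1 (Finset.mem_subtype.1 hU)
    rw [single_monomial_eq_term, tsub_add_cancel_of_le (mdeg_mono hUW),
      monomial_smul_term (mdeg_mono hUW), tsub_add_cancel_of_le hα]
  rw [Finset.smul_sum, Finset.sum_congr rfl h1,
    Finset.sum_subtype_eq_sum_filter (f := fun U => X.term k α U (c * X.sign W U))]
  refine Finset.sum_subset (Finset.filter_subset _ _) fun U hU hn => ?_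
  exact term_of_notMem (fun h => hn (Finset.mem_filter.2 ⟨hU, h⟩)) _

/-- The `k`-span of the terms of homological degree `i` whose multidegree lies in `P`. -/
noncomputable def gpart (X : LabelledCellComplex σ V) (k : Type*) [Field k] (i : ℕ) (P : Set (σ →₀ ℕ)) :
    Submodule k (X.FreeModule k) :=
  Submodule.span k {f | ∃ α ∈ P, ∃ W ∈ X.cells, X.rank W = i ∧ X.mdeg W ≤ α ∧ f = X.term k α W 1}

theorem term_eq_smul (α : σ →₀ ℕ) (W : Finset V) (c : k) :
    X.term k α W c = c • X.term k α W 1 := by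
  rw [← map_smul, smul_eq_mul, mul_one]

theorem term_mem_gpart {i : ℕ} {P : Set (σ →₀ ℕ)} {α : σ →₀ ℕ} {W : Finset V} (hα : α ∈ P)
    (hr : W ∈ X.cells → X.rank W = i) (hle : X.mdeg W ≤ α) (c : k) :
    X.term k α W c ∈ X.gpart k i P := by
  by_cases hW : W ∈ X.cells
  · rw [term_eq_smul]
    exact Submodule.smul_mem _ _ (Submodule.subset_span ⟨α, hα, W, hW, hr hW, hle, rfl⟩)
  · rw [term_of_notMem hW]; exact Submodule.zero_mem _

theorem gpart_mono {i : ℕ} {P Q : Set (σ →₀ ℕ)} (h : P ⊆ Q) : X.gpart k i P ≤ X.gpart k i Q :=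
  Submodule.span_mono fun _ ⟨α, hα, hf⟩ => ⟨α, h hα, hf⟩

theorem mem_gpart_iff {i : ℕ} {P : Set (σ →₀ ℕ)} {f : X.FreeModule k} :
    f ∈ X.gpart k i P ↔ f ∈ X.hpart k i ∧
      ∀ (W : X.cells) (e : σ →₀ ℕ), (f W).coeff e ≠ 0 → e + X.mdeg W ∈ P := by
  classical
  constructor
  · intro hf
    induction hf using Submodule.span_induction with
    | mem f hf =>
      obtain ⟨α, hα, W, hW, hr, hle, rfl⟩ := hf
      rw [term_of_mem hW]
      refine ⟨Finsupp.single_mem_supported _ _ hr, fun U e h => ?_⟩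
      rw [Finsupp.single_apply] at h
      split_ifs at h with hU
      · subst hU
        rw [MvPolynomial.coeff_monomial] at h
        split_ifs at h with he
        · rw [← he, tsub_add_cancel_of_le hle]; exact hα
        · exact absurd rfl h
      · exact absurd (MvPolynomial.coeff_zero _) h
    | zero => exact ⟨Submodule.zero_mem _, fun W e h => absurd (by simp) h⟩
    | add f g _ _ hf hg =>
      refine ⟨Submodule.add_mem _ hf.1 hg.1, fun W e h => ?_⟩
      by_cases h0 : (f W).coeff e = 0
      · refine hg.2 W e fun h1 => h ?_
        rw [Finsupp.add_apply, MvPolynomial.coeff_add, h0, h1, add_zero]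
      · exact hf.2 W e h0
    | smul c f _ hf =>
      refine ⟨?_, fun W e h => hf.2 W e fun h0 => h ?_⟩
      · have : c • f = (MvPolynomial.C c : MvPolynomial σ k) • f := by
          ext W; simp [MvPolynomial.smul_eq_C_mul]
        rw [this]; exact Submodule.smul_mem _ _ hf.1
      · rw [Finsupp.smul_apply, MvPolynomial.coeff_smul, h0, smul_zero]
  · rintro ⟨hf, hP⟩
    rw [← Finsupp.sum_single f]
    refine Submodule.sum_mem _ fun W hW => ?_
    have hr : X.rank W = i := (Finsupp.mem_supported _ _).1 hf hW
    rw [MvPolynomial.as_sum (f W), Finsupp.single_finsetSum]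
    refine Submodule.sum_mem _ fun e he => ?_
    rw [single_monomial_eq_term]
    exact term_mem_gpart (hP W e (MvPolynomial.mem_support_iff.1 he)) (fun _ => hr)
      le_add_self _

theorem mem_hpart_iff {i : ℕ} {f : X.FreeModule k} :
    f ∈ X.hpart k i ↔ f ∈ X.gpart k i Set.univ := by
  simp [mem_gpart_iff]

theorem mem_hpart_of_mem_gpart {i : ℕ} {P : Set (σ →₀ ℕ)} {f : X.FreeModule k}
    (hf : f ∈ X.gpart k i P) : f ∈ X.hpart k i :=
  (mem_gpart_iff.1 hf).1

theorem monomial_smul_mem_gpart {i : ℕ} {P Q : Set (σ →₀ ℕ)} {f : X.FreeModule k}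
    (hf : f ∈ X.gpart k i P) (e : σ →₀ ℕ) (c : k) (h : ∀ α ∈ P, e + α ∈ Q) :
    MvPolynomial.monomial e c • f ∈ X.gpart k i Q := by
  induction hf using Submodule.span_induction with
  | mem f hf =>
    obtain ⟨α, hα, W, hW, hr, hle, rfl⟩ := hf
    rw [monomial_smul_term hle]
    exact term_mem_gpart (h α hα) (fun _ => hr) (hle.trans le_add_self) _
  | zero => rw [smul_zero]; exact Submodule.zero_mem _
  | add f g _ _ hf hg => rw [smul_add]; exact Submodule.add_mem _ hf hg
  | smul c f _ hf => rw [smul_comm]; exact Submodule.smul_mem _ _ hf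

theorem d_mem_gpart {i : ℕ} {P : Set (σ →₀ ℕ)} {f : X.FreeModule k}
    (hf : f ∈ X.gpart k (i + 1) P) : X.d k f ∈ X.gpart k i P := by
  induction hf using Submodule.span_induction with
  | mem f hf =>
    obtain ⟨α, hα, W, hW, hr, hle, rfl⟩ := hf
    rw [d_term hW hle]
    refine Submodule.sum_mem _ fun U hU => ?_
    have hU := Finset.mem_powerset.1 hU
    by_cases h : U ∈ X.cells ∧ X.rank U ≠ i
    · rw [X.sign_of_not_facet W hW U h.1 (fun h' => h.2 (by omega)), Int.cast_zero, mul_zero,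
        map_zero]
      exact Submodule.zero_mem _
    · exact term_mem_gpart hα (fun h' => by_contra fun hn => h ⟨h', hn⟩)
        ((mdeg_mono hU).trans hle) _
  | zero => rw [map_zero]; exact Submodule.zero_mem _
  | add f g _ _ hf hg => rw [map_add]; exact Submodule.add_mem _ hf hg
  | smul c f _ hf => rw [LinearMap.map_smul_of_tower]; exact Submodule.smul_mem _ _ hf

theorem d_d (f : X.FreeModule k) : X.d k (X.d k f) = 0 := by
  classical
  induction f using Finsupp.induction_linear with
  | zero => simp
  | add f g hf hg => rw [map_add, map_add, hf, hg, add_zero]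
  | single W p =>
    induction p using MvPolynomial.induction_on' with
    | add p q hp hq => rw [Finsupp.single_add, map_add, map_add, hp, hq, add_zero]
    | monomial e c =>
      have hle : X.mdeg W ≤ e + X.mdeg W := le_add_self
      rw [single_monomial_eq_term, d_term W.2 hle, map_sum]
      set α := e + X.mdeg W
      -- Every inner sum is padded with zeros to all subsets of W, so that the two sums can be
      -- exchanged and `sign_comp` applied for each fixed T.
      have h1 : ∀ U ∈ W.1.powerset, X.d k (X.term k α U (c * X.sign W U)) =
          ∑ T ∈ W.1.powerset, X.term k α T
            (if U ∈ X.cells then c * (X.sign W U * X.sign U T : ℤ) else 0) := by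
        intro U hU
        have hU := Finset.mem_powerset.1 hU
        by_cases hc : U ∈ X.cells
        · rw [d_term hc ((mdeg_mono hU).trans hle)]
          simp only [hc, if_true]
          refine (Finset.sum_subset (Finset.powerset_mono.2 hU) fun T _ hT => ?_).trans
            (Finset.sum_congr rfl fun T _ => ?_)
          · by_cases hTc : T ∈ X.cells
            · rw [X.sign_of_not_facet U hc T hTc
                (fun h => hT (Finset.mem_powerset.2 h.1)), Int.cast_zero, mul_zero, map_zero]
            · exact term_of_notMem hTc _
          · push_cast; rw [mul_assoc]
        · simp [hc, term_of_notMem hc]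
      rw [Finset.sum_congr rfl h1, Finset.sum_comm]
      refine Finset.sum_eq_zero fun T _ => ?_
      rw [← map_sum]
      by_cases hTc : T ∈ X.cells
      · rw [← Finset.sum_filter, ← Finset.mul_sum, ← Int.cast_sum]
        have := X.sign_comp W W.2 T hTc
        rw [show ∑ U ∈ W.1.powerset with U ∈ X.cells, X.sign W U * X.sign U T = 0 by
          convert this]
        simp
      · exact term_of_notMem hTc _

theorem gpart_eq_bot {i : ℕ} {P : Set (σ →₀ ℕ)}
    (h : ∀ W ∈ X.cells, X.rank W = i → ∀ α ∈ P, ¬ X.mdeg W ≤ α) : X.gpart k i P = ⊥ := by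
  rw [gpart, Submodule.span_eq_bot]
  rintro f ⟨α, hα, W, hW, hr, hle, rfl⟩
  exact absurd hle (h W hW hr α hα)

/-! ### The contracting homotopy given by coning. -/

section Simplicial

variable [DecidableEq V]

theorem IsSimplicial.d_term (hX : X.IsSimplicial) {α : σ →₀ ℕ} {W : Finset V} (hW : W ∈ X.cells)
    (hα : X.mdeg W ≤ α) (c : k) :
    X.d k (X.term k α W c) =
      ∑ v ∈ W, X.term k α (W.erase v) (c * X.sign W (W.erase v)) := by
  rw [LabelledCellComplex.d_term hW hα]
  have hinj : Set.InjOn (fun v => W.erase v) (W : Set V) := W.erase_injOn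
  rw [← Finset.sum_image (f := fun U => X.term k α U (c * X.sign W U)) hinj]
  symm
  refine Finset.sum_subset ?_ fun U hU hn => ?_
  · intro U hU
    obtain ⟨v, _, rfl⟩ := Finset.mem_image.1 hU
    exact Finset.mem_powerset.2 (Finset.erase_subset _ _)
  · have hU := Finset.mem_powerset.1 hU
    have hUc := hX.subset_mem W hW U hU
    rw [X.sign_of_not_facet W hW U hUc, Int.cast_zero, mul_zero, map_zero]
    rintro ⟨_, h⟩
    rw [hX.rank_eq W hW, hX.rank_eq U hUc] at h
    have h1 : (W \ U).card = 1 := by rw [Finset.card_sdiff_of_subset hU]; omega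
    obtain ⟨v, hv⟩ := Finset.card_eq_one.1 h1
    have hvW : v ∈ W \ U := by rw [hv]; exact Finset.mem_singleton_self v
    refine hn (Finset.mem_image.2 ⟨v, (Finset.mem_sdiff.1 hvW).1, ?_⟩)
    rw [Finset.erase_eq, ← hv, Finset.sdiff_sdiff_eq_self hU]

theorem IsSimplicial.sign_erase (hX : X.IsSimplicial) {W : Finset V} (hW : W ∈ X.cells) {v : V}
    (hv : v ∈ W) : X.sign W (W.erase v) = 1 ∨ X.sign W (W.erase v) = -1 := by
  have h := hX.subset_mem W hW _ (Finset.erase_subset v W)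
  refine X.sign_of_facet W hW _ h (Finset.erase_subset v W) ?_
  rw [hX.rank_eq W hW, hX.rank_eq _ h, Finset.card_erase_add_one hv]

theorem IsSimplicial.sign_mul_self (hX : X.IsSimplicial) {W : Finset V} (hW : W ∈ X.cells) {v : V}
    (hv : v ∈ W) : (X.sign W (W.erase v) : k) * X.sign W (W.erase v) = 1 := by
  rcases hX.sign_erase hW hv with h | h <;> simp [h]

theorem IsSimplicial.sign_ne_zero (hX : X.IsSimplicial) {W : Finset V} (hW : W ∈ X.cells) {v : V}
    (hv : v ∈ W) : (X.sign W (W.erase v) : k) ≠ 0 := by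
  rcases hX.sign_erase hW hv with h | h <;> simp [h]

theorem IsSimplicial.sign_erase_erase (hX : X.IsSimplicial) {W : Finset V} (hW : W ∈ X.cells)
    {a b : V} (ha : a ∈ W) (hb : b ∈ W) (hab : a ≠ b) :
    X.sign W (W.erase a) * X.sign (W.erase a) ((W.erase a).erase b) +
      X.sign W (W.erase b) * X.sign (W.erase b) ((W.erase a).erase b) = 0 := by
  classical
  have hs : (W.erase a).erase b ⊆ W := (Finset.erase_subset _ _).trans (Finset.erase_subset _ _)
  have hT := hX.subset_mem W hW _ hs
  have hpair : W.erase a ≠ W.erase b := fun heq =>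
    Finset.notMem_erase b W (heq ▸ Finset.mem_erase.2 ⟨hab.symm, hb⟩)
  rw [← Finset.sum_pair hpair
    (f := fun U => X.sign W U * X.sign U ((W.erase a).erase b)),
    ← X.sign_comp W hW _ hT]
  refine (Finset.sum_subset ?_ ?_).trans (by congr!)
  · intro U hU
    have hU : U ⊆ W := by
      rcases Finset.mem_insert.1 hU with rfl | hU
      · exact Finset.erase_subset _ _
      · rw [Finset.mem_singleton.1 hU]; exact Finset.erase_subset _ _
    exact Finset.mem_filter.2 ⟨Finset.mem_powerset.2 hU, hX.subset_mem W hW U hU⟩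
  · intro U hU hn
    obtain ⟨hUW, hUc⟩ := Finset.mem_filter.1 hU
    have hUW := Finset.mem_powerset.1 hUW
    by_contra h0
    have h1 : (W.erase a).erase b ⊆ U ∧ X.rank U = X.rank ((W.erase a).erase b) + 1 := by
      by_contra h; exact h0 (by rw [X.sign_of_not_facet U hUc _ hT h, mul_zero])
    have hcard := h1.2
    rw [hX.rank_eq U hUc, hX.rank_eq _ hT] at hcard
    have h2 : (U \ (W.erase a).erase b).card = 1 := by
      rw [Finset.card_sdiff_of_subset h1.1]; omega
    obtain ⟨v, hv⟩ := Finset.card_eq_one.1 h2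
    have hU' : U = insert v ((W.erase a).erase b) := by
      rw [Finset.insert_eq, ← hv, Finset.sdiff_union_of_subset h1.1]
    have hv' : v ∈ U \ (W.erase a).erase b := by rw [hv]; exact Finset.mem_singleton_self v
    rw [Finset.mem_sdiff] at hv'
    have hvW := hUW hv'.1
    apply hn
    have hvab : v = a ∨ v = b := by
      by_contra! h
      exact hv'.2 (Finset.mem_erase.2 ⟨h.2, Finset.mem_erase.2 ⟨h.1, hvW⟩⟩)
    rcases hvab with rfl | rfl
    · rw [hU', Finset.erase_right_comm, Finset.insert_erase (Finset.mem_erase.2 ⟨hab, ha⟩)]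
      simp
    · rw [hU', Finset.insert_erase (Finset.mem_erase.2 ⟨hab.symm, hb⟩)]
      simp

/-- For every multidegree `α` the subcomplex of the cells of degree at most `α` is empty or a cone
with apex `q α`. -/
structure IsConeSystem (X : LabelledCellComplex σ V) (q : (σ →₀ ℕ) → V) : Prop where
  insert_mem : ∀ α, ∀ W ∈ X.cells, W.Nonempty → X.mdeg W ≤ α → insert (q α) W ∈ X.cells
  label_le : ∀ α, ∀ W ∈ X.cells, W.Nonempty → X.mdeg W ≤ α → X.label (q α) ≤ α

open scoped Classical in
/-- The cone `x ^ e • g_W ↦ ± x ^ e' • g_{W ∪ q}`. -/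
noncomputable def coneTerm (X : LabelledCellComplex σ V) (k : Type*) [Field k]
    (q : (σ →₀ ℕ) → V) (α : σ →₀ ℕ) (W : Finset V) : k →ₗ[k] X.FreeModule k :=
  if q α ∉ W ∧ X.mdeg (insert (q α) W) ≤ α then
    (X.sign (insert (q α) W) W : k) • X.term k α (insert (q α) W) else 0

/-- The contracting homotopy given by coning. -/
noncomputable def cone (X : LabelledCellComplex σ V) (k : Type*) [Field k]
    (q : (σ →₀ ℕ) → V) : X.FreeModule k →ₗ[k] X.FreeModule k :=
  -- The apex depends on the multidegree, so the homotopy is only k-linear and is defined on the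
  -- k-basis x ^ e • g_W.
  Finsupp.lsum k fun W : X.cells =>
    (MvPolynomial.basisMonomials σ k).constr k fun e => X.coneTerm k q (e + X.mdeg W) W 1

theorem cone_term {q : (σ →₀ ℕ) → V} {α : σ →₀ ℕ} {W : Finset V} (hW : W ∈ X.cells)
    (hα : X.mdeg W ≤ α) (c : k) : X.cone k q (X.term k α W c) = X.coneTerm k q α W c := by
  rw [term_of_mem hW, cone, Finsupp.lsum_single,
    show MvPolynomial.monomial (α - X.mdeg W) c =
      c • MvPolynomial.basisMonomials σ k (α - X.mdeg W) by
        simp [MvPolynomial.smul_monomial],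
    map_smul, Module.Basis.constr_basis, tsub_add_cancel_of_le hα, ← map_smul, smul_eq_mul,
    mul_one]

theorem mdeg_insert_le {α : σ →₀ ℕ} {W : Finset V} {v : V} :
    X.mdeg (insert v W) ≤ α ↔ X.label v ≤ α ∧ X.mdeg W ≤ α := by
  rw [mdeg, mdeg, Finset.sup_insert, sup_le_iff]

theorem cone_mem_gpart (hX : X.IsSimplicial) (q : (σ →₀ ℕ) → V) {i : ℕ} {P : Set (σ →₀ ℕ)}
    {f : X.FreeModule k} (hf : f ∈ X.gpart k i P) : X.cone k q f ∈ X.gpart k (i + 1) P := by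
  induction hf using Submodule.span_induction with
  | mem f hf =>
    obtain ⟨α, hα, W, hW, hr, hle, rfl⟩ := hf
    rw [cone_term hW hle, coneTerm]
    split_ifs with h
    · refine Submodule.smul_mem _ _ (term_mem_gpart hα (fun h' => ?_) h.2 _)
      rw [hX.rank_eq _ h', Finset.card_insert_of_notMem h.1, ← hX.rank_eq W hW, hr]
    · exact Submodule.zero_mem _
  | zero => rw [map_zero]; exact Submodule.zero_mem _
  | add f g _ _ hf hg => rw [map_add]; exact Submodule.add_mem _ hf hg
  | smul c f _ hf => rw [map_smul]; exact Submodule.smul_mem _ _ hf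

/-- If the apex lies in W, the cone of the term is 0, and in the cone of the boundary only the facet
opposite the apex survives. Otherwise that facet of the coned cell returns the term, and the other
facets cancel against the cone of the boundary. -/
theorem d_cone_add_cone_d_term (hX : X.IsSimplicial) {q : (σ →₀ ℕ) → V} (hq : X.IsConeSystem q)
    {α : σ →₀ ℕ} {W : Finset V} (hW : W ∈ X.cells) (hne : W.Nonempty) (hα : X.mdeg W ≤ α) (c : k) :
    X.d k (X.cone k q (X.term k α W c)) + X.cone k q (X.d k (X.term k α W c)) =
      X.term k α W c := by
  have hins := hq.insert_mem α W hW hne hα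
  have hins_le : X.mdeg (insert (q α) W) ≤ α :=
    mdeg_insert_le.2 ⟨hq.label_le α W hW hne hα, hα⟩
  have herase : ∀ v, W.erase v ∈ X.cells := fun v =>
    hX.subset_mem W hW _ (Finset.erase_subset v W)
  have hele : ∀ v, X.mdeg (W.erase v) ≤ α := fun v =>
    (mdeg_mono (Finset.erase_subset v W)).trans hα
  rw [cone_term hW hα, hX.d_term hW hα, map_sum]
  simp only [cone_term (herase _) (hele _)]
  by_cases hqW : q α ∈ W
  · rw [coneTerm, if_neg (fun h => h.1 hqW), LinearMap.zero_apply, map_zero, zero_add,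
      Finset.sum_eq_single_of_mem (q α) hqW]
    · rw [coneTerm, if_pos]
      · rw [Finset.insert_erase hqW, LinearMap.smul_apply, ← map_smul, smul_eq_mul,
          mul_left_comm, hX.sign_mul_self hW hqW, mul_one]
      · rw [Finset.insert_erase hqW]
        exact ⟨Finset.notMem_erase _ _, hα⟩
    · intro v _ hv
      rw [coneTerm, if_neg, LinearMap.zero_apply]
      exact fun h => h.1 (Finset.mem_erase.2 ⟨hv.symm, hqW⟩)
  · rw [coneTerm, if_pos ⟨hqW, hins_le⟩, LinearMap.smul_apply, ← map_smul, smul_eq_mul,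
      hX.d_term hins hins_le, Finset.sum_insert hqW, Finset.erase_insert hqW, add_assoc,
      ← Finset.sum_add_distrib, Finset.sum_eq_zero, add_zero]
    · have := hX.sign_mul_self (k := k) hins (Finset.mem_insert_self (q α) W)
      rw [Finset.erase_insert hqW] at this
      rw [mul_right_comm, this, one_mul]
    · intro v hv
      have hvq : v ≠ q α := fun h => hqW (h ▸ hv)
      have hcomm : (insert (q α) W).erase v = insert (q α) (W.erase v) :=
        Finset.erase_insert_of_ne hvq.symm
      have hle : X.mdeg (insert (q α) (W.erase v)) ≤ α := by
        rw [← hcomm]; exact (mdeg_mono (Finset.erase_subset _ _)).trans hins_le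
      rw [coneTerm, if_pos ⟨fun h => hqW (Finset.mem_of_mem_erase h), hle⟩,
        LinearMap.smul_apply, ← map_smul, hcomm, ← map_add, smul_eq_mul]
      have := hX.sign_erase_erase hins (Finset.mem_insert_self (q α) W)
        (Finset.mem_insert_of_mem hv) hvq.symm
      rw [Finset.erase_insert hqW, hcomm] at this
      have this' := congrArg (Int.cast : ℤ → k) this
      push_cast at this'
      rw [show (X.sign (insert (q α) W) W : k) * c * X.sign (insert (q α) W)
        (insert (q α) (W.erase v)) + X.sign (insert (q α) (W.erase v)) (W.erase v) *
        (c * X.sign W (W.erase v)) = 0 from ?_, map_zero]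
      have h1 := hX.sign_mul_self (k := k) hins (Finset.mem_insert_self (q α) W)
      rw [Finset.erase_insert hqW] at h1
      have hins' : insert (q α) (W.erase v) ∈ X.cells := by
        rw [← hcomm]; exact hX.subset_mem _ hins _ (Finset.erase_subset _ _)
      have h2 := hX.sign_mul_self (k := k) hins (Finset.mem_insert_of_mem (a := v) hv)
      rw [hcomm] at h2
      have h3 := hX.sign_mul_self (k := k) hins' (Finset.mem_insert_self (q α) (W.erase v))
      rw [Finset.erase_insert (fun h => hqW (Finset.mem_of_mem_erase h))] at h3
      generalize (X.sign (insert (q α) W) W : k) = s at *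
      generalize (X.sign (insert (q α) W) (insert (q α) (W.erase v)) : k) = t at *
      generalize (X.sign (insert (q α) (W.erase v)) (W.erase v) : k) = u at *
      generalize (X.sign W (W.erase v) : k) = r at *
      -- The two paths from the coned cell to W minus v cancel: s r + t u = 0, and all signs square
      -- to 1.
      have h4 : t = - s * r * u := by linear_combination u * this' - t * h3
      rw [h4]
      linear_combination -c * r * u * h1

/-- Homological degree 0 is excluded: the homology there need not vanish, and a cone system says
nothing about the empty cell. -/
theorem d_cone_add_cone_d (hX : X.IsSimplicial) {q : (σ →₀ ℕ) → V} (hq : X.IsConeSystem q) {i : ℕ}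
    {f : X.FreeModule k} (hf : f ∈ X.hpart k (i + 1)) :
    X.d k (X.cone k q f) + X.cone k q (X.d k f) = f := by
  rw [mem_hpart_iff] at hf
  induction hf using Submodule.span_induction with
  | mem f hf =>
    obtain ⟨α, hα, W, hW, hr, hle, rfl⟩ := hf
    refine d_cone_add_cone_d_term hX hq hW ?_ hle 1
    rw [Finset.nonempty_iff_ne_empty, Ne, ← X.rank_eq_zero_iff W hW]
    omega
  | zero => simp
  | add f g _ _ hf hg =>
    rw [map_add, map_add, map_add, map_add, add_add_add_comm, hf, hg]
  | smul c f _ hf =>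
    rw [map_smul, LinearMap.map_smul_of_tower, LinearMap.map_smul_of_tower, map_smul, ← smul_add,
      hf]

theorem exact_of_isConeSystem (hX : X.IsSimplicial) {q : (σ →₀ ℕ) → V} (hq : X.IsConeSystem q)
    (i : ℕ) (f : X.FreeModule k) (hf : f ∈ X.hpart k (i + 1)) :
    X.d k f = 0 ↔ ∃ g ∈ X.hpart k (i + 2), X.d k g = f := by
  constructor
  · intro h
    refine ⟨X.cone k q f, mem_hpart_iff.2 (cone_mem_gpart hX q (mem_hpart_iff.1 hf)), ?_⟩
    have := d_cone_add_cone_d hX hq hf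
    rwa [h, map_zero, add_zero] at this
  · rintro ⟨g, _, rfl⟩
    exact d_d g

/-- Where the next module vanishes, an element inherits the multidegrees of its boundary. -/
theorem mem_gpart_of_d_mem (hX : X.IsSimplicial) {q : (σ →₀ ℕ) → V} (hq : X.IsConeSystem q) {i : ℕ}
    {P Q : Set (σ →₀ ℕ)} {f : X.FreeModule k} (hf : f ∈ X.gpart k (i + 1) P)
    (hP : ∀ W ∈ X.cells, X.rank W = i + 2 → ∀ α ∈ P, ¬ X.mdeg W ≤ α)
    (hd : X.d k f ∈ X.gpart k i Q) : f ∈ X.gpart k (i + 1) Q := by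
  have h1 := d_cone_add_cone_d hX hq (mem_hpart_of_mem_gpart hf)
  have h2 := cone_mem_gpart hX q hf
  -- The cone of f lies in a zero space, so f is the cone of its boundary, and coning preserves
  -- multidegrees.
  rw [gpart_eq_bot hP, Submodule.mem_bot] at h2
  rw [h2, map_zero, zero_add] at h1
  rw [← h1]
  exact cone_mem_gpart hX q hd

end Simplicial

end LabelledCellComplex

/-! ### The five generators. -/

/-- The exponents of `xy, zw, x², y²z², w²`. -/
def genExponent : Fin 5 → Fin 4 → ℕ :=
  ![![1, 1, 0, 0], ![0, 0, 1, 1], ![2, 0, 0, 0], ![0, 2, 2, 0], ![0, 0, 0, 2]]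

/-- The exponent vectors of `xy, zw, x², y²z², w²`. -/
noncomputable def genVector (v : Fin 5) : Fin 4 →₀ ℕ :=
  Finsupp.equivFunOnFinite.symm (genExponent v)

theorem genVector_apply (v : Fin 5) (j : Fin 4) : genVector v j = genExponent v j := rfl

theorem genVector_le_iff {v : Fin 5} {α : Fin 4 →₀ ℕ} :
    genVector v ≤ α ↔ ∀ j, genExponent v j ≤ α j := Iff.rfl

theorem sup_genVector_apply (W : Finset (Fin 5)) (j : Fin 4) :
    W.sup genVector j = W.sup fun v => genExponent v j := by
  induction W using Finset.induction_on with
  | empty => rfl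
  | insert a W _ ih => rw [Finset.sup_insert, Finset.sup_insert, Finsupp.sup_apply, ih]; rfl

theorem monomial_genVector (k : Type*) [Field k] (v : Fin 5) :
    MvPolynomial.monomial (genVector v) (1 : k) =
      ![MvPolynomial.X 0 * MvPolynomial.X 1, MvPolynomial.X 2 * MvPolynomial.X 3,
        MvPolynomial.X 0 ^ 2, MvPolynomial.X 1 ^ 2 * MvPolynomial.X 2 ^ 2,
        MvPolynomial.X 3 ^ 2] v := by
  rw [MvPolynomial.monomial_eq, MvPolynomial.C_1, one_mul, Finsupp.prod_fintype _ _ (by simp),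
    Fin.prod_univ_four]
  simp only [genVector_apply]
  fin_cases v <;> simp [genExponent]

theorem eq_genVector {k : Type*} [Field k] {m : Fin 5 → Fin 4 →₀ ℕ}
    (hm : ∀ i, MvPolynomial.monomial (m i) (1 : k) =
      ![MvPolynomial.X 0 * MvPolynomial.X 1, MvPolynomial.X 2 * MvPolynomial.X 3,
        MvPolynomial.X 0 ^ 2, MvPolynomial.X 1 ^ 2 * MvPolynomial.X 2 ^ 2,
        MvPolynomial.X 3 ^ 2] i) : m = genVector := by
  funext v
  exact MvPolynomial.monomial_left_injective (one_ne_zero (α := k))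
    ((hm v).trans (monomial_genVector k v).symm)

/-- The ideal `⟨x², xy, y²z², zw, w²⟩`. -/
noncomputable def genIdeal (k : Type*) [Field k] : Ideal (MvPolynomial (Fin 4) k) :=
  Ideal.span ((fun a => MvPolynomial.monomial a (1 : k)) '' Set.range genVector)

theorem span_eq_genIdeal (k : Type*) [Field k] :
    Ideal.span {MvPolynomial.X 0 ^ 2, MvPolynomial.X 0 * MvPolynomial.X 1,
      MvPolynomial.X 1 ^ 2 * MvPolynomial.X 2 ^ 2, MvPolynomial.X 2 * MvPolynomial.X 3,
      MvPolynomial.X 3 ^ 2} = genIdeal k := by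
  rw [genIdeal]
  congr 1
  ext p
  simp only [Set.mem_insert_iff, Set.mem_singleton_iff, Set.mem_image, Set.exists_range_iff,
    monomial_genVector, Fin.exists_fin_succ, Fin.exists_fin_zero]
  simp [eq_comm]
  tauto

theorem monomial_mem_genIdeal {k : Type*} [Field k] {α : Fin 4 →₀ ℕ} :
    MvPolynomial.monomial α (1 : k) ∈ genIdeal k ↔ ∃ v, genVector v ≤ α := by
  rw [genIdeal, MvPolynomial.mem_ideal_span_monomial_image]
  simp

theorem genVector_le_genVector {u v : Fin 5} (h : genVector u ≤ genVector v) : u = v := by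
  have : ∀ u v : Fin 5, (∀ j, genExponent u j ≤ genExponent v j) → u = v := by decide
  exact this u v h

theorem listsMinimalGenerators_genIdeal (k : Type*) [Field k] :
    ListsMinimalGenerators (genIdeal k) genVector := by
  refine ⟨fun u v h => genVector_le_genVector h.le, ?_⟩
  ext α
  simp only [Set.mem_range, Set.mem_ofPred_eq, Minimal, monomial_mem_genIdeal]
  constructor
  · rintro ⟨v, rfl⟩
    refine ⟨⟨v, le_rfl⟩, fun β ⟨u, hu⟩ hβ => ?_⟩
    rwa [← genVector_le_genVector (hu.trans hβ)]
  · rintro ⟨⟨v, hv⟩, h⟩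
    exact ⟨v, le_antisymm hv (h ⟨v, le_rfl⟩ hv)⟩

theorem isMonomialIdeal_genIdeal (k : Type*) [Field k] : IsMonomialIdeal (genIdeal k) :=
  ⟨_, rfl⟩

/-! ### The Scarf complex and the minimal resolution. -/

/-- The faces of the Scarf complex of `genIdeal`, the empty one included. -/
def IsScarfFace (W : Finset (Fin 5)) : Prop :=
  ¬ {2, 3} ⊆ W ∧ ¬ {3, 4} ⊆ W

instance : DecidablePred IsScarfFace := fun _ => inferInstanceAs (Decidable (_ ∧ _))

theorem IsScarfFace.mono {U W : Finset (Fin 5)} (h : U ⊆ W) (hW : IsScarfFace W) :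
    IsScarfFace U :=
  ⟨fun h' => hW.1 (h'.trans h), fun h' => hW.2 (h'.trans h)⟩

/-- The order of `Fin 5` is the prescribed order of the generators. The pair {2,3} is excluded by xy
and {3,4} by zw; the finite check shows that no further set is excluded. -/
theorem mem_lyubeznikComplex_iff (W : Finset (Fin 5)) :
    W ∈ (lyubeznikComplex genVector).faces ↔ W.Nonempty ∧ IsScarfFace W := by
  have h : ∀ W : Finset (Fin 5), (∀ i ∈ W, ∀ q < i, ¬ ∀ j, genExponent q j ≤
      (W.filter (i ≤ ·)).sup fun v => genExponent v j) ↔ IsScarfFace W := by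
    decide +kernel
  change W.Nonempty ∧ _ ↔ _
  simp only [genVector_le_iff, sup_genVector_apply]
  rw [h]

namespace LabelledCellComplex

/-- `X` is the Scarf complex of `genIdeal`, with an arbitrary incidence function. -/
structure IsScarf (X : LabelledCellComplex (Fin 4) (Fin 5)) : Prop where
  mem_cells_iff : ∀ W, W ∈ X.cells ↔ IsScarfFace W
  rank_eq : ∀ W ∈ X.cells, X.rank W = W.card
  label_eq : X.label = genVector

variable {X : LabelledCellComplex (Fin 4) (Fin 5)}

theorem IsScarf.isSimplicial (hX : X.IsScarf) : X.IsSimplicial where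
  rank_eq := hX.rank_eq
  subset_mem W hW U hU := by
    rw [hX.mem_cells_iff] at hW ⊢
    exact hW.mono hU

theorem IsScarf.mdeg_apply (hX : X.IsScarf) (W : Finset (Fin 5)) (j : Fin 4) :
    X.mdeg W j = W.sup fun v => genExponent v j := by
  rw [mdeg, hX.label_eq, sup_genVector_apply]

/-- The first element of `S`. -/
def firstVertex (S : Finset (Fin 5)) : Fin 5 :=
  if 0 ∈ S then 0 else if 1 ∈ S then 1 else if 2 ∈ S then 2 else if 3 ∈ S then 3 else 4

open scoped Classical in
/-- The apex of the subcomplex of the faces of degree at most `α`. -/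
noncomputable def scarfApex (α : Fin 4 →₀ ℕ) : Fin 5 :=
  firstVertex (Finset.univ.filter fun v => genVector v ≤ α)

theorem IsScarf.isConeSystem (hX : X.IsScarf) : X.IsConeSystem scarfApex := by
  classical
  have hmem : ∀ S : Finset (Fin 5), S.Nonempty → firstVertex S ∈ S := by decide +kernel
  -- S is the set of generators dividing x ^ α. An apex 0 or 1 lies in no forbidden pair. If the
  -- apex is 2, then 0 is not in S, hence neither is 3; if it is 3, then 1 is not in S, hence
  -- neither is 4.
  have key : ∀ S : Finset (Fin 5), ({2, 3} ⊆ S → 0 ∈ S) → ({3, 4} ⊆ S → 1 ∈ S) →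
      ∀ W ∈ S.powerset, IsScarfFace W → IsScarfFace (insert (firstVertex S) W) := by
    decide +kernel
  have hsub : ∀ α : Fin 4 →₀ ℕ, ∀ W : Finset (Fin 5), X.mdeg W ≤ α →
      W ⊆ Finset.univ.filter fun v => genVector v ≤ α := by
    intro α W hα v hv
    refine Finset.mem_filter.2 ⟨Finset.mem_univ v, le_trans ?_ hα⟩
    rw [← hX.label_eq]
    exact Finset.le_sup hv
  refine ⟨fun α W hW _ hα => ?_, fun α W hW hne hα => ?_⟩
  · rw [hX.mem_cells_iff] at hW ⊢
    refine key _ ?_ ?_ W (Finset.mem_powerset.2 (hsub α W hα)) hW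
    · intro h
      have h2 := (Finset.mem_filter.1 (h (by simp : (2 : Fin 5) ∈ _))).2
      have h3 := (Finset.mem_filter.1 (h (by simp : (3 : Fin 5) ∈ _))).2
      simp only [Finset.mem_filter, Finset.mem_univ, true_and, genVector_le_iff,
        Fin.forall_fin_succ] at h2 h3 ⊢
      simp [genExponent] at h2 h3 ⊢
      omega
    · intro h
      have h2 := (Finset.mem_filter.1 (h (by simp : (3 : Fin 5) ∈ _))).2
      have h3 := (Finset.mem_filter.1 (h (by simp : (4 : Fin 5) ∈ _))).2
      simp only [Finset.mem_filter, Finset.mem_univ, true_and, genVector_le_iff,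
        Fin.forall_fin_succ] at h2 h3 ⊢
      simp [genExponent] at h2 h3 ⊢
      omega
  · rw [hX.label_eq]
    exact (Finset.mem_filter.1 (hmem _ (hne.mono (hsub α W hα)))).2

theorem IsScarf.isMinimalFreeResolution (hX : X.IsScarf) (k : Type*) [Field k] :
    X.IsMinimalFreeResolution (genIdeal k) where
  exact := exact_of_isConeSystem hX.isSimplicial hX.isConeSystem
  coker s := by
    have hvert : ∀ v, ({v} : Finset (Fin 5)) ∈ X.cells := fun v => by
      rw [hX.mem_cells_iff]; revert v; decide
    have hd : ∀ v, ∀ α, X.mdeg {v} ≤ α → ∀ c : k,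
        X.d k (X.term k α {v} c) = X.unit k (MvPolynomial.monomial α c) := by
      intro v α hα c
      have h1 := X.sign_vertex {v} (hvert v) (hX.rank_eq _ (hvert v))
      rw [hX.isSimplicial.d_term (hvert v) hα, Finset.sum_singleton,
        Finset.erase_singleton, h1, term_of_mem X.empty_mem, unit]
      simp [mdeg, bot_eq_zero]
    constructor
    · rintro ⟨g, hg, hs⟩
      have hmem : X.d k g ⟨∅, X.empty_mem⟩ ∈ genIdeal k := by
        clear hs
        rw [mem_hpart_iff] at hg
        induction hg using Submodule.span_induction with
        | mem f hf =>
          obtain ⟨α, _, W, hW, hr, hle, rfl⟩ := hf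
          rw [hX.rank_eq W hW] at hr
          obtain ⟨v, rfl⟩ := Finset.card_eq_one.1 hr
          rw [hd v α hle, unit, Finsupp.single_eq_same, monomial_mem_genIdeal]
          exact ⟨v, by rwa [mdeg, hX.label_eq, Finset.sup_singleton] at hle⟩
        | zero => simp
        | add f g _ _ hf hg => rw [map_add]; exact Ideal.add_mem _ hf hg
        | smul c f _ hf =>
          rw [LinearMap.map_smul_of_tower, Finsupp.smul_apply, MvPolynomial.smul_eq_C_mul]
          exact Ideal.mul_mem_left _ _ hf
      rwa [hs, unit, Finsupp.single_eq_same] at hmem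
    · intro hs
      have hle : genIdeal k ≤ ((X.hpart k 1).map (X.d k)).comap
          (Finsupp.lsingle ⟨∅, X.empty_mem⟩) := by
        rw [genIdeal, Ideal.span, Submodule.span_le]
        rintro _ ⟨_, ⟨v, rfl⟩, rfl⟩
        have hv : X.mdeg {v} ≤ genVector v := by
          rw [mdeg, hX.label_eq, Finset.sup_singleton]
        exact ⟨X.term k (genVector v) {v} 1, mem_hpart_iff.2 (term_mem_gpart (Set.mem_univ _)
          (fun h => hX.rank_eq _ h) hv 1), hd v _ hv 1⟩
      exact hle hs
  minimal f W := by
    -- Each vertex of a face contributes properly to the lcm, so no quotient m_W / m_U in the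
    -- differential is 1.
    have hdeg : ∀ W : Finset (Fin 5), IsScarfFace W → ∀ v ∈ W, ∃ j,
        ((W.erase v).sup fun v => genExponent v j) ≠ W.sup fun v => genExponent v j := by
      decide +kernel
    induction f using Finsupp.induction_linear with
    | zero => simp
    | add f g hf hg => rw [map_add]; exact Ideal.add_mem _ hf hg
    | single U p =>
      induction p using MvPolynomial.induction_on' with
      | add p q hp hq => rw [Finsupp.single_add, map_add]; exact Ideal.add_mem _ hp hq
      | monomial e c =>
        rw [single_monomial_eq_term, hX.isSimplicial.d_term U.2 le_add_self,
          Finsupp.finsetSum_apply]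
        refine Ideal.sum_mem _ fun v hv => ?_
        have hc := hX.isSimplicial.subset_mem U U.2 _ (Finset.erase_subset v U)
        rw [term_of_mem hc, Finsupp.single_apply]
        split_ifs with hW
        · obtain ⟨j, hj⟩ := hdeg U ((hX.mem_cells_iff _).1 U.2) v hv
          rw [← hX.mdeg_apply, ← hX.mdeg_apply] at hj
          have hlt : X.mdeg (U.1.erase v) j < X.mdeg U j :=
            lt_of_le_of_ne (mdeg_mono (Finset.erase_subset v U.1) j) hj
          rw [MvPolynomial.idealOfVars, ← Set.image_univ, MvPolynomial.mem_ideal_span_X_image]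
          intro a ha
          have ha := Finset.mem_singleton.1 (MvPolynomial.support_monomial_subset ha)
          refine ⟨j, Set.mem_univ j, ?_⟩
          rw [ha, Finsupp.tsub_apply, Finsupp.add_apply]
          omega
        · exact Ideal.zero_mem _

end LabelledCellComplex

/-! ### Coordinates, and the unit of a graded DGA. -/

namespace LabelledCellComplex

section General

variable {σ V : Type*} {X : LabelledCellComplex σ V} {k : Type*} [Field k]

/-- The multidegrees of total degree `n`. -/
def ofDegree (σ : Type*) (n : ℕ) : Set (σ →₀ ℕ) := {α | α.degree = n}

/-- The basis element `g_W`. -/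
noncomputable def cell (X : LabelledCellComplex σ V) (k : Type*) [Field k] (W : Finset V) :
    X.FreeModule k :=
  X.term k (X.mdeg W) W 1

open scoped Classical in
/-- The coefficient of the basis element `g_W`. -/
noncomputable def coord (X : LabelledCellComplex σ V) (k : Type*) [Field k] (W : Finset V) :
    X.FreeModule k →ₗ[MvPolynomial σ k] MvPolynomial σ k :=
  if h : W ∈ X.cells then Finsupp.lapply ⟨W, h⟩ else 0

theorem coord_of_mem {W : Finset V} (h : W ∈ X.cells) (f : X.FreeModule k) :
    X.coord k W f = f ⟨W, h⟩ := by
  simp [coord, h]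

theorem cell_of_mem {W : Finset V} (h : W ∈ X.cells) :
    X.cell k W = Finsupp.single ⟨W, h⟩ 1 := by
  rw [cell, term_of_mem h, tsub_self]; rfl

theorem term_eq_smul_cell {α : σ →₀ ℕ} {W : Finset V} (hα : X.mdeg W ≤ α) (c : k) :
    X.term k α W c = MvPolynomial.monomial (α - X.mdeg W) c • X.cell k W := by
  rw [cell, monomial_smul_term le_rfl, mul_one, tsub_add_cancel_of_le hα]

theorem coord_cell_self {W : Finset V} (h : W ∈ X.cells) : X.coord k W (X.cell k W) = 1 := by
  rw [coord_of_mem h, cell_of_mem h, Finsupp.single_eq_same]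

theorem coord_cell_of_ne {U W : Finset V} (h : U ≠ W) : X.coord k U (X.cell k W) = 0 := by
  classical
  by_cases hW : W ∈ X.cells
  · by_cases hU : U ∈ X.cells
    · rw [coord_of_mem hU, cell_of_mem hW, Finsupp.single_apply, if_neg]
      exact fun h' => h (congrArg Subtype.val h').symm
    · simp [coord, hU]
  · rw [cell, term_of_notMem hW, map_zero]

theorem cell_mem_gpart {W : Finset V} {i : ℕ} (h : W ∈ X.cells → X.rank W = i) :
    X.cell k W ∈ X.gpart k i {X.mdeg W} :=
  term_mem_gpart (Set.mem_singleton _) h le_rfl 1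

theorem coord_d_cell {W U : Finset V} (hW : W ∈ X.cells) (hU : U ∈ X.cells) :
    X.coord k U (X.d k (X.cell k W)) =
      MvPolynomial.monomial (X.mdeg W - X.mdeg U) (X.sign W U : k) := by
  classical
  rw [cell, d_term hW le_rfl, map_sum]
  have h1 : ∀ U' ∈ W.powerset, U' ≠ U →
      X.coord k U (X.term k (X.mdeg W) U' (1 * X.sign W U')) = 0 := by
    intro U' hU' hne
    rw [term_eq_smul_cell (mdeg_mono (Finset.mem_powerset.1 hU')), map_smul,
      coord_cell_of_ne hne.symm, smul_zero]
  by_cases h : U ⊆ W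
  · rw [Finset.sum_eq_single_of_mem U (Finset.mem_powerset.2 h) h1,
      term_eq_smul_cell (mdeg_mono h), map_smul, coord_cell_self hU, smul_eq_mul, mul_one, one_mul]
  · rw [X.sign_of_not_facet W hW U hU (fun h' => h h'.1), Int.cast_zero, map_zero]
    exact Finset.sum_eq_zero fun U' hU' =>
      h1 U' hU' fun he => h (he ▸ Finset.mem_powerset.1 hU')

theorem map_mem_of_cells {N : Type*} [AddCommGroup N] [Module (MvPolynomial σ k) N]
    (L : X.FreeModule k →ₗ[MvPolynomial σ k] N) (J : Submodule (MvPolynomial σ k) N)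
    {f : X.FreeModule k} (h : ∀ W : X.cells, f W ≠ 0 → f W • L (X.cell k W) ∈ J) : L f ∈ J := by
  rw [← Finsupp.sum_single f, Finsupp.sum, map_sum]
  refine Submodule.sum_mem _ fun W hW => ?_
  have : (Finsupp.single W (f W) : X.FreeModule k) = f W • X.cell k W := by
    rw [cell_of_mem W.2, Finsupp.smul_single, smul_eq_mul, mul_one]
  rw [this, map_smul]
  exact h W (Finsupp.mem_support_iff.1 hW)

/-- The tool for computing modulo an ideal: expand L f over the cells of rank i and discard each
cell either through its coefficient in f or through the value of L on it. -/
theorem map_mem_of_hpart {i : ℕ} (L : X.FreeModule k →ₗ[MvPolynomial σ k] MvPolynomial σ k)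
    (J : Ideal (MvPolynomial σ k)) {f : X.FreeModule k} (hf : f ∈ X.hpart k i)
    (h : ∀ W ∈ X.cells, X.rank W = i → X.coord k W f ∈ J ∨ L (X.cell k W) ∈ J) : L f ∈ J := by
  refine map_mem_of_cells L J fun W hW => ?_
  have hr : X.rank W = i := (Finsupp.mem_supported _ _).1 hf (Finsupp.mem_support_iff.2 hW)
  rcases h W W.2 hr with h | h
  · rw [coord_of_mem W.2] at h; exact Ideal.mul_mem_right _ _ h
  · exact Ideal.mul_mem_left _ _ h

theorem mem_gpart_ofDegree_iff {i n : ℕ} {f : X.FreeModule k} :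
    f ∈ X.gpart k i (ofDegree σ n) ↔ f ∈ X.hpart k i ∧ X.IsHomogeneousOfDegree f n := by
  rw [mem_gpart_iff]
  simp only [ofDegree, Set.mem_ofPred_eq, map_add, IsHomogeneousOfDegree]

/-- A multiplication which makes the complex a DGA and respects the standard grading. -/
structure IsGradedDGA (X : LabelledCellComplex σ V)
    (mul : X.FreeModule k →ₗ[MvPolynomial σ k] X.FreeModule k →ₗ[MvPolynomial σ k]
      X.FreeModule k) : Prop extends X.IsDGAStructure mul where
  homogeneous : ∀ (a b : X.FreeModule k) (p q : ℕ), X.IsHomogeneousOfDegree a p →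
    X.IsHomogeneousOfDegree b q → X.IsHomogeneousOfDegree (mul a b) (p + q)

variable {mul : X.FreeModule k →ₗ[MvPolynomial σ k] X.FreeModule k →ₗ[MvPolynomial σ k]
  X.FreeModule k}

theorem IsGradedDGA.mul_mem_gpart (h : X.IsGradedDGA mul) {i j p q : ℕ} {a b : X.FreeModule k}
    (ha : a ∈ X.gpart k i (ofDegree σ p)) (hb : b ∈ X.gpart k j (ofDegree σ q)) :
    mul a b ∈ X.gpart k (i + j) (ofDegree σ (p + q)) := by
  rw [mem_gpart_ofDegree_iff] at *
  exact ⟨h.mul_mem i j a ha.1 b hb.1, h.homogeneous a b p q ha.2 hb.2⟩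

theorem cell_empty : X.cell k ∅ = X.unit k 1 := by
  rw [cell_of_mem X.empty_mem]; rfl

theorem d_unit [DecidableEq V] (hX : X.IsSimplicial) : X.d k (X.unit k 1) = 0 := by
  rw [← cell_empty, cell, hX.d_term X.empty_mem le_rfl, Finset.sum_empty]

/-- By minimality ∂f has no constant coefficients, so the monomials in front of g_W have positive
degree. -/
theorem degree_lt_of_d_apply_ne_zero
    (hmin : ∀ (f : X.FreeModule k) W, X.d k f W ∈ MvPolynomial.idealOfVars σ k) {i n : ℕ}
    {f : X.FreeModule k} (hf : f ∈ X.gpart k (i + 1) (ofDegree σ n)) (W : X.cells)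
    (hW : X.d k f W ≠ 0) : (X.mdeg W).degree < n := by
  obtain ⟨e, he⟩ := MvPolynomial.ne_zero_iff.1 hW
  have h1 := (mem_gpart_iff.1 (d_mem_gpart hf)).2 W e he
  have h2 : e.degree + (X.mdeg W).degree = n := by rw [← map_add]; exact h1
  have h3 : e ≠ 0 := by
    rintro rfl
    have := hmin f W
    rw [← pow_one (MvPolynomial.idealOfVars σ k), MvPolynomial.mem_pow_idealOfVars_iff'] at this
    exact he (this 0 (by simp))
  have h4 : e.degree ≠ 0 := fun h => h3 ((Finsupp.degree_eq_zero_iff e).1 h)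
  omega

/-- In a graded DGA structure on a minimal resolution `1 : S` is a unit element. -/
theorem IsGradedDGA.unit_mul [DecidableEq V] (h : X.IsGradedDGA mul) (hX : X.IsSimplicial)
    {q : (σ →₀ ℕ) → V} (hq : X.IsConeSystem q)
    (hmin : ∀ (f : X.FreeModule k) W, X.d k f W ∈ MvPolynomial.idealOfVars σ k)
    (f : X.FreeModule k) : mul (X.unit k 1) f = f := by
  have hsum : ∀ f : X.FreeModule k,
      (∀ W : X.cells, f W ≠ 0 → mul (X.unit k 1) (X.cell k W) = X.cell k W) →
      mul (X.unit k 1) f = f := by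
    intro f hf
    have := map_mem_of_cells (mul (X.unit k 1) - LinearMap.id) ⊥ (f := f) fun W hW => by
      simp [hf W hW]
    simpa [sub_eq_zero] using this
  -- The axioms fix only the products inside degree 0. By induction on total degree 1 * ∂x = ∂x, so
  -- y = x − 1 * x is a cycle and hence the boundary of its cone. By minimality y involves only
  -- cells of smaller total degree, so 1 * y = y; associativity gives 1 * y = 0.
  have hcell : ∀ n, ∀ W ∈ X.cells, (X.mdeg W).degree = n →
      mul (X.unit k 1) (X.cell k W) = X.cell k W := by
    intro n
    induction n using Nat.strong_induction_on with
    | _ n ih =>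
      intro W hW hn
      by_cases hne : W = ∅
      · rw [hne, cell_empty, h.mul_unit, one_mul]
      obtain ⟨i, hi⟩ := Nat.exists_eq_succ_of_ne_zero (mt (X.rank_eq_zero_iff W hW).1 hne)
      set x := X.cell k W with hx
      set u := X.unit k 1 with hu
      have hxm : x ∈ X.gpart k (i + 1) (ofDegree σ n) :=
        gpart_mono (Set.singleton_subset_iff.2 hn) (cell_mem_gpart fun _ => hi)
      have hum : u ∈ X.gpart k 0 (ofDegree σ 0) := by
        rw [hu, ← cell_empty]
        refine gpart_mono (Set.singleton_subset_iff.2 ?_)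
          (cell_mem_gpart fun h => (X.rank_eq_zero_iff _ h).2 rfl)
        simp [mdeg, ofDegree, bot_eq_zero]
      have hux := h.mul_mem_gpart hum hxm
      rw [zero_add, zero_add] at hux
      have hdx : mul u (X.d k x) = X.d k x := hsum _ fun U hU =>
        ih _ (degree_lt_of_d_apply_ne_zero hmin hxm U hU) U U.2 rfl
      set y := x - mul u x with hy
      have hym : y ∈ X.gpart k (i + 1) (ofDegree σ n) := Submodule.sub_mem _ hxm hux
      have hdy : X.d k y = 0 := by
        rw [hy, map_sub, h.leibniz 0 u (mem_hpart_of_mem_gpart hum), d_unit hX, hdx]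
        simp
      have hyd := d_cone_add_cone_d hX hq (mem_hpart_of_mem_gpart hym)
      rw [hdy, map_zero, add_zero] at hyd
      have huy : mul u y = y := hsum _ fun U hU =>
        ih _ (degree_lt_of_d_apply_ne_zero hmin (cone_mem_gpart hX q hym) U
          (by rwa [hyd])) U U.2 rfl
      have huy' : mul u y = 0 := by
        rw [hy, map_sub, ← h.assoc, h.mul_unit, one_mul, sub_self]
      rw [huy'] at huy
      exact (sub_eq_zero.1 huy.symm).symm
  exact hsum f fun W _ => hcell _ W W.2 rfl

theorem IsGradedDGA.mul_unit_one [DecidableEq V] (h : X.IsGradedDGA mul) (hX : X.IsSimplicial)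
    {q : (σ →₀ ℕ) → V} (hq : X.IsConeSystem q)
    (hmin : ∀ (f : X.FreeModule k) W, X.d k f W ∈ MvPolynomial.idealOfVars σ k) {i : ℕ}
    {f : X.FreeModule k} (hf : f ∈ X.hpart k i) : mul f (X.unit k 1) = f := by
  have hu : X.unit k 1 ∈ X.hpart k 0 :=
    Finsupp.single_mem_supported _ _ ((X.rank_eq_zero_iff _ X.empty_mem).2 rfl)
  rw [h.comm i 0 f hf _ hu, h.unit_mul hX hq hmin]
  simp

/-- If W is the only cell of rank i whose monomial divides x ^ α, one term spans the piece of
multidegree α. -/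
theorem exists_eq_smul_cell_of_mem_gpart {i : ℕ} {α : σ →₀ ℕ} {W : Finset V}
    (hα : X.mdeg W ≤ α) (huniq : ∀ U ∈ X.cells, X.rank U = i → X.mdeg U ≤ α → U = W)
    {f : X.FreeModule k} (hf : f ∈ X.gpart k i {α}) :
    ∃ c : k, f = MvPolynomial.monomial (α - X.mdeg W) c • X.cell k W := by
  simp only [← term_eq_smul_cell hα]
  induction hf using Submodule.span_induction with
  | mem f hf =>
    obtain ⟨β, rfl, U, hU, hr, hle, rfl⟩ := hf
    exact ⟨1, by rw [huniq U hU hr hle]⟩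
  | zero => exact ⟨0, by simp⟩
  | add f g _ _ hf hg =>
    obtain ⟨a, rfl⟩ := hf
    obtain ⟨b, rfl⟩ := hg
    exact ⟨a + b, by rw [map_add]⟩
  | smul c f _ hf =>
    obtain ⟨a, rfl⟩ := hf
    exact ⟨c • a, by rw [map_smul]⟩

theorem coord_eq_zero_of_mem_gpart {i : ℕ} {α : σ →₀ ℕ} {W : Finset V}
    (hα : ¬ X.mdeg W ≤ α) {f : X.FreeModule k} (hf : f ∈ X.gpart k i {α}) :
    X.coord k W f = 0 := by
  induction hf using Submodule.span_induction with
  | mem f hf =>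
    obtain ⟨β, rfl, U, hU, hr, hle, rfl⟩ := hf
    rw [term_eq_smul_cell hle, map_smul, coord_cell_of_ne, smul_zero]
    rintro rfl
    exact hα hle
  | zero => simp
  | add f g _ _ hf hg => rw [map_add, hf, hg, add_zero]
  | smul c f _ hf => rw [LinearMap.map_smul_of_tower, hf, smul_zero]

end General

end LabelledCellComplex

/-! ### Setting variables to zero. -/

/-- The substitution of `0` for the variables in `s`. -/
noncomputable def killVars (k : Type*) [Field k] (s : Finset (Fin 4)) :
    MvPolynomial (Fin 4) k →ₐ[k] MvPolynomial (Fin 4) k :=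
  MvPolynomial.aeval fun i => if i ∈ s then 0 else MvPolynomial.X i

theorem killVars_monomial_eq_zero {k : Type*} [Field k] {s : Finset (Fin 4)} {e : Fin 4 →₀ ℕ}
    {i : Fin 4} (hi : i ∈ s) (he : e i ≠ 0) (c : k) :
    killVars k s (MvPolynomial.monomial e c) = 0 := by
  rw [killVars, MvPolynomial.aeval_monomial, Finsupp.prod_fintype _ _ (by simp),
    Finset.prod_eq_zero (Finset.mem_univ i) (by simp [hi, he]), mul_zero]

theorem killVars_monomial {k : Type*} [Field k] {s : Finset (Fin 4)} {e : Fin 4 →₀ ℕ}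
    (he : ∀ i ∈ s, e i = 0) (c : k) :
    killVars k s (MvPolynomial.monomial e c) = MvPolynomial.monomial e c := by
  rw [killVars, MvPolynomial.aeval_monomial, MvPolynomial.monomial_eq]
  congr 1
  refine Finsupp.prod_congr fun i hi => ?_
  rw [if_neg]
  exact fun h => Finsupp.mem_support_iff.1 hi (he i h)

theorem killVars_killVars {k : Type*} [Field k] {s t : Finset (Fin 4)} (h : s ⊆ t)
    (p : MvPolynomial (Fin 4) k) : killVars k t (killVars k s p) = killVars k t p := by
  have : (killVars k t).comp (killVars k s) = killVars k t := by
    ext1 i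
    simp only [killVars, AlgHom.comp_apply, MvPolynomial.aeval_X]
    split_ifs with h1 h2 h2
    · simp
    · exact absurd (h h1) h2
    · simp [h2]
    · simp [h2]
  exact DFunLike.congr_fun this p

/-! ### Products in low degree on the Scarf complex. -/

namespace LabelledCellComplex

variable {X : LabelledCellComplex (Fin 4) (Fin 5)} {k : Type*} [Field k]

theorem IsScarf.mdeg_singleton (hX : X.IsScarf) (v : Fin 5) : X.mdeg {v} = genVector v := by
  rw [mdeg, hX.label_eq, Finset.sup_singleton]

theorem IsScarf.degree_mdeg (hX : X.IsScarf) (W : Finset (Fin 5)) :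
    (X.mdeg W).degree = ∑ j, W.sup fun v => genExponent v j := by
  rw [Finsupp.degree_eq_sum]
  exact Finset.sum_congr rfl fun j _ => hX.mdeg_apply W j

theorem degree_genVector (v : Fin 5) : (genVector v).degree = ∑ j, genExponent v j := by
  rw [Finsupp.degree_eq_sum]; rfl

theorem isScarfFace_singleton (v : Fin 5) : IsScarfFace {v} := by
  revert v; decide

theorem IsScarf.mem_cells (hX : X.IsScarf) {W : Finset (Fin 5)} (h : IsScarfFace W) :
    W ∈ X.cells := (hX.mem_cells_iff W).2 h

theorem IsScarf.d_vertex (hX : X.IsScarf) (v : Fin 5) :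
    X.d k (X.cell k {v}) = MvPolynomial.monomial (genVector v) (1 : k) • X.unit k 1 := by
  have hv : ({v} : Finset (Fin 5)) ∈ X.cells := hX.mem_cells (isScarfFace_singleton v)
  have h1 := X.sign_vertex {v} hv (hX.rank_eq _ hv)
  rw [cell, hX.isSimplicial.d_term hv le_rfl, Finset.sum_singleton, Finset.erase_singleton, h1,
    term_eq_smul_cell (mdeg_mono (Finset.empty_subset _)), cell_empty, hX.mdeg_singleton]
  simp [mdeg, bot_eq_zero]

theorem IsScarf.vertex_mem_gpart (hX : X.IsScarf) (v : Fin 5) :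
    X.cell k {v} ∈ X.gpart k 1 {genVector v} := by
  rw [← hX.mdeg_singleton]
  exact cell_mem_gpart fun h => hX.rank_eq _ h

theorem IsScarf.vertex_mem_hpart (hX : X.IsScarf) (v : Fin 5) : X.cell k {v} ∈ X.hpart k 1 :=
  mem_hpart_of_mem_gpart (hX.vertex_mem_gpart v)

theorem IsScarf.edge_mem_hpart (hX : X.IsScarf) {W : Finset (Fin 5)} (hW : W.card = 2) :
    X.cell k W ∈ X.hpart k 2 :=
  mem_hpart_of_mem_gpart (cell_mem_gpart fun h => (hX.rank_eq _ h).trans hW)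

theorem degree_genVector_of_ne {v : Fin 5} (hv : v ≠ 3) : (genVector v).degree = 2 := by
  rw [degree_genVector]; revert v; decide

theorem IsScarf.vertex_mem_gpart_ofDegree (hX : X.IsScarf) {v : Fin 5} (hv : v ≠ 3) :
    X.cell k {v} ∈ X.gpart k 1 (ofDegree (Fin 4) 2) :=
  gpart_mono (Set.singleton_subset_iff.2 (degree_genVector_of_ne hv)) (hX.vertex_mem_gpart v)

theorem IsScarf.not_mdeg_le (hX : X.IsScarf) {i n : ℕ}
    (h : ∀ W : Finset (Fin 5), IsScarfFace W → W.card = i →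
      n < ∑ j, W.sup fun v => genExponent v j) :
    ∀ W ∈ X.cells, X.rank W = i → ∀ α ∈ ofDegree (Fin 4) n, ¬ X.mdeg W ≤ α := by
  intro W hW hr α hα hle
  rw [hX.rank_eq W hW] at hr
  have h1 := h W ((hX.mem_cells_iff W).1 hW) hr
  have h2 := Finsupp.degree_mono hle
  rw [hX.degree_mdeg, show α.degree = n from hα] at h2
  omega

variable {mul : X.FreeModule k →ₗ[MvPolynomial (Fin 4) k] X.FreeModule k →ₗ[MvPolynomial (Fin 4) k]
  X.FreeModule k}

theorem IsGradedDGA.unit_mul_of_isScarf (h : X.IsGradedDGA mul) (hX : X.IsScarf)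
    (f : X.FreeModule k) : mul (X.unit k 1) f = f :=
  h.unit_mul hX.isSimplicial hX.isConeSystem (hX.isMinimalFreeResolution k).minimal f

theorem IsGradedDGA.d_vertex_mul (h : X.IsGradedDGA mul) (hX : X.IsScarf) (u : Fin 5)
    (f : X.FreeModule k) :
    X.d k (mul (X.cell k {u}) f) =
      MvPolynomial.monomial (genVector u) (1 : k) • f - mul (X.cell k {u}) (X.d k f) := by
  rw [h.leibniz 1 _ (hX.vertex_mem_hpart u), hX.d_vertex, map_smul, LinearMap.smul_apply,
    h.unit_mul_of_isScarf hX, pow_one, neg_smul, one_smul, sub_eq_add_neg]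

theorem IsGradedDGA.d_vertex_mul_vertex (h : X.IsGradedDGA mul) (hX : X.IsScarf) (u v : Fin 5) :
    X.d k (mul (X.cell k {u}) (X.cell k {v})) =
      MvPolynomial.monomial (genVector u) (1 : k) • X.cell k {v} -
        MvPolynomial.monomial (genVector v) (1 : k) • X.cell k {u} := by
  rw [h.d_vertex_mul hX, hX.d_vertex, map_smul,
    h.mul_unit_one hX.isSimplicial hX.isConeSystem (hX.isMinimalFreeResolution k).minimal
      (hX.vertex_mem_hpart u)]

/-- The product has total degree 4, whereas faces with three vertices have degree at least 5. So the
product inherits the multidegree of its boundary. The quartic y²z² must be left out. -/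
theorem IsGradedDGA.vertex_mul_vertex_mem (h : X.IsGradedDGA mul) (hX : X.IsScarf) {u v : Fin 5}
    (hu : u ≠ 3) (hv : v ≠ 3) :
    mul (X.cell k {u}) (X.cell k {v}) ∈ X.gpart k 2 {genVector u + genVector v} := by
  refine mem_gpart_of_d_mem hX.isSimplicial hX.isConeSystem
    (h.mul_mem_gpart (hX.vertex_mem_gpart_ofDegree hu) (hX.vertex_mem_gpart_ofDegree hv))
    (hX.not_mdeg_le (by decide +kernel)) ?_
  rw [h.d_vertex_mul_vertex hX]
  refine Submodule.sub_mem _ (monomial_smul_mem_gpart (hX.vertex_mem_gpart v) _ _ ?_)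
    (monomial_smul_mem_gpart (hX.vertex_mem_gpart u) _ _ ?_)
  · rintro _ rfl; rfl
  · rintro _ rfl; exact add_comm _ _

/-- Graded commutativity yields only 2 (g * g) = 0, which is void in characteristic 2. Instead, no
edge has an lcm dividing x⁴ or w⁴. -/
theorem IsGradedDGA.vertex_mul_self (h : X.IsGradedDGA mul) (hX : X.IsScarf) {u : Fin 5}
    (hu : u = 2 ∨ u = 4) : mul (X.cell k {u}) (X.cell k {u}) = 0 := by
  have hu' : u ≠ 3 := by rintro rfl; revert hu; decide
  have h1 := h.vertex_mul_vertex_mem hX hu' hu'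
  rw [gpart_eq_bot, Submodule.mem_bot] at h1
  · exact h1
  rintro W hW hr _ rfl hle
  have key : ∀ u : Fin 5, u = 2 ∨ u = 4 → ∀ W : Finset (Fin 5), IsScarfFace W → W.card = 2 → ¬ ∀ j,
      (W.sup fun v => genExponent v j) ≤ genExponent u j + genExponent u j := by decide +kernel
  refine key u hu W ((hX.mem_cells_iff W).1 hW) ((hX.rank_eq W hW).symm.trans hr) fun j => ?_
  rw [← hX.mdeg_apply]
  exact hle j

/-- Only the edge {u,v} has an lcm dividing m_u m_v. The scalar is nonzero because the boundary of
the product has coefficient m_u at g_v. -/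
theorem IsGradedDGA.exists_vertex_mul_vertex_eq (h : X.IsGradedDGA mul) (hX : X.IsScarf)
    {u v : Fin 5} (hu : u ≠ 3) (hv : v ≠ 3) (huv : u ≠ v) :
    ∃ c : k, c ≠ 0 ∧ mul (X.cell k {u}) (X.cell k {v}) =
      MvPolynomial.monomial (genVector u + genVector v - X.mdeg {u, v}) c • X.cell k {u, v} := by
  have hle : X.mdeg {u, v} ≤ genVector u + genVector v := by
    rw [mdeg, hX.label_eq]
    simp [Finset.sup_insert]
  have key : ∀ u v : Fin 5, u ≠ 3 → v ≠ 3 → u ≠ v → ∀ W : Finset (Fin 5), IsScarfFace W →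
      W.card = 2 → (∀ j, (W.sup fun v => genExponent v j) ≤ genExponent u j + genExponent v j) →
      W = {u, v} := by decide +kernel
  obtain ⟨c, hc⟩ := exists_eq_smul_cell_of_mem_gpart hle (fun W hW hr hle => key u v hu hv huv W
    ((hX.mem_cells_iff W).1 hW) ((hX.rank_eq W hW).symm.trans hr) fun j => by
      rw [← hX.mdeg_apply]; exact hle j) (h.vertex_mul_vertex_mem hX hu hv)
  refine ⟨c, ?_, hc⟩
  rintro rfl
  have hd := h.d_vertex_mul_vertex hX u v
  have hv' : ({v} : Finset (Fin 5)) ∈ X.cells := hX.mem_cells (isScarfFace_singleton v)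
  rw [hc, map_zero, zero_smul, map_zero] at hd
  have := congrArg (X.coord k {v}) hd
  rw [map_zero, map_sub, map_smul, map_smul, coord_cell_self hv', coord_cell_of_ne] at this
  · simp [eq_comm (a := (0 : MvPolynomial (Fin 4) k))] at this
  · simpa using huv.symm

theorem IsGradedDGA.exists_edge_eq (h : X.IsGradedDGA mul) (hX : X.IsScarf)
    {u v : Fin 5} (hu : u ≠ 3) (hv : v ≠ 3) (huv : u ≠ v)
    (hdisj : ∀ j, genExponent u j = 0 ∨ genExponent v j = 0) :
    ∃ c : k, X.cell k {u, v} =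
      (MvPolynomial.C c : MvPolynomial (Fin 4) k) • mul (X.cell k {u}) (X.cell k {v}) := by
  obtain ⟨c, hc0, hc⟩ := h.exists_vertex_mul_vertex_eq hX hu hv huv
  have he : genVector u + genVector v - X.mdeg {u, v} = 0 := by
    ext j
    rw [Finsupp.tsub_apply, Finsupp.add_apply, hX.mdeg_apply, genVector_apply, genVector_apply,
      Finset.sup_insert, Finset.sup_singleton]
    rcases hdisj j with h | h <;> simp [h]
  refine ⟨c⁻¹, ?_⟩
  rw [hc, he, smul_smul, ← MvPolynomial.C_apply, ← map_mul, inv_mul_cancel₀ hc0, map_one, one_smul]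

/-- A generator dividing a monomial of degree 3 is not y²z², so products of quadric vertices
suffice. -/
theorem IsGradedDGA.vertex_mul_mem (h : X.IsGradedDGA mul) (hX : X.IsScarf) {u : Fin 5}
    (hu : u ≠ 3) {β : Fin 4 →₀ ℕ} (hβ : β.degree = 3) {f : X.FreeModule k}
    (hf : f ∈ X.gpart k 1 {β}) : mul (X.cell k {u}) f ∈ X.gpart k 2 {genVector u + β} := by
  induction hf using Submodule.span_induction with
  | mem f hf =>
    obtain ⟨_, rfl, W, hW, hr, hle, rfl⟩ := hf
    rw [hX.rank_eq W hW] at hr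
    obtain ⟨v, rfl⟩ := Finset.card_eq_one.1 hr
    have hv : v ≠ 3 := by
      rintro rfl
      have := Finsupp.degree_mono hle
      rw [hX.degree_mdeg, hβ] at this
      revert this; decide
    rw [term_eq_smul_cell hle, map_smul]
    refine monomial_smul_mem_gpart (h.vertex_mul_vertex_mem hX hu hv) _ _ ?_
    rintro _ rfl
    rw [Set.mem_singleton_iff, add_left_comm, hX.mdeg_singleton,
      tsub_add_cancel_of_le (by rwa [← hX.mdeg_singleton])]
  | zero => rw [map_zero]; exact Submodule.zero_mem _
  | add f g _ _ hf hg => rw [map_add]; exact Submodule.add_mem _ hf hg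
  | smul c f _ hf => rw [LinearMap.map_smul_of_tower]; exact Submodule.smul_mem _ _ hf

/-- The product has total degree 2 + 3 = 5, and the only face with four vertices, {0,1,2,4}, has
degree 6. -/
theorem IsGradedDGA.vertex_mul_edge_mem (h : X.IsGradedDGA mul) (hX : X.IsScarf) {u : Fin 5}
    (hu : u ≠ 3) {W : Finset (Fin 5)} (hW : W.card = 2)
    (hβ : ∑ j, (W.sup fun v => genExponent v j) = 3) :
    mul (X.cell k {u}) (X.cell k W) ∈ X.gpart k 3 {genVector u + X.mdeg W} := by
  have hβ' : (X.mdeg W).degree = 3 := (hX.degree_mdeg W).trans hβ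
  have hcell : X.cell k W ∈ X.gpart k 2 {X.mdeg W} :=
    cell_mem_gpart fun h => (hX.rank_eq W h).trans hW
  have hdeg : X.cell k W ∈ X.gpart k 2 (ofDegree (Fin 4) 3) :=
    gpart_mono (Set.singleton_subset_iff.2 hβ') hcell
  have hprod : mul (X.cell k {u}) (X.cell k W) ∈ X.gpart k (2 + 1) (ofDegree (Fin 4) 5) :=
    h.mul_mem_gpart (i := 1) (j := 2) (p := 2) (q := 3) (hX.vertex_mem_gpart_ofDegree hu) hdeg
  refine mem_gpart_of_d_mem hX.isSimplicial hX.isConeSystem hprod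
    (hX.not_mdeg_le (by decide +kernel)) ?_
  rw [h.d_vertex_mul hX]
  refine Submodule.sub_mem _ (monomial_smul_mem_gpart hcell _ _ ?_)
    (h.vertex_mul_mem hX hu hβ' (d_mem_gpart hcell))
  rintro _ rfl; rfl

end LabelledCellComplex

/-! ### The failure of associativity modulo ⟨x, w⟩. -/

/-- The ideal `⟨x, w⟩`. -/
noncomputable def outerIdeal (k : Type*) [Field k] : Ideal (MvPolynomial (Fin 4) k) :=
  RingHom.ker (killVars k {0, 3})

theorem mem_outerIdeal {k : Type*} [Field k] {p : MvPolynomial (Fin 4) k} :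
    p ∈ outerIdeal k ↔ killVars k {0, 3} p = 0 := RingHom.mem_ker

theorem monomial_mem_outerIdeal {k : Type*} [Field k] {e : Fin 4 →₀ ℕ}
    (he : e 0 ≠ 0 ∨ e 3 ≠ 0) (c : k) : MvPolynomial.monomial e c ∈ outerIdeal k := by
  rw [mem_outerIdeal]
  rcases he with he | he
  · exact killVars_monomial_eq_zero (by simp) he c
  · exact killVars_monomial_eq_zero (by simp) he c

theorem monomial_notMem_outerIdeal {k : Type*} [Field k] {e : Fin 4 →₀ ℕ}
    (he : e 0 = 0 ∧ e 3 = 0) {c : k} (hc : c ≠ 0) : MvPolynomial.monomial e c ∉ outerIdeal k := by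
  rw [mem_outerIdeal, killVars_monomial (by simpa using he), MvPolynomial.monomial_eq_zero]
  exact hc

namespace LabelledCellComplex

variable {X : LabelledCellComplex (Fin 4) (Fin 5)} {k : Type*} [Field k]

theorem edge_cases {W : Finset (Fin 5)} (h : IsScarfFace W) (hc : W.card = 2) :
    W = {0, 1} ∨ W = {0, 2} ∨ W = {0, 3} ∨ W = {0, 4} ∨ W = {1, 2} ∨ W = {1, 3} ∨ W = {1, 4} ∨
      W = {2, 4} := by
  revert W; decide +kernel

theorem IsScarf.monomial_mdeg_sub_mem (hX : X.IsScarf) (W U : Finset (Fin 5)) (c : k)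
    (h : (U.sup fun v => genExponent v 0) < (W.sup fun v => genExponent v 0) ∨
      (U.sup fun v => genExponent v 3) < W.sup fun v => genExponent v 3) :
    MvPolynomial.monomial (X.mdeg W - X.mdeg U) c ∈ outerIdeal k := by
  refine monomial_mem_outerIdeal ?_ c
  rw [Finsupp.tsub_apply, Finsupp.tsub_apply, hX.mdeg_apply, hX.mdeg_apply, hX.mdeg_apply,
    hX.mdeg_apply]
  omega

theorem IsScarf.coord_d_edge (hX : X.IsScarf) {W : Finset (Fin 5)} (hW : IsScarfFace W)
    {v : Fin 5} : X.coord k {v} (X.d k (X.cell k W)) =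
      MvPolynomial.monomial (X.mdeg W - X.mdeg {v}) (X.sign W {v} : k) :=
  coord_d_cell (hX.mem_cells hW) (hX.mem_cells (isScarfFace_singleton v))

theorem IsScarf.coord_d_edge_eq_zero (hX : X.IsScarf) {W : Finset (Fin 5)} (hW : IsScarfFace W)
    {v : Fin 5} (hv : v ∉ W) : X.coord k {v} (X.d k (X.cell k W)) = 0 := by
  rw [hX.coord_d_edge hW, X.sign_of_not_facet W (hX.mem_cells hW) _
    (hX.mem_cells (isScarfFace_singleton v)) (fun h => hv (Finset.singleton_subset_iff.1 h.1)),
    Int.cast_zero, map_zero]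

/-- If `∂ f` has the coefficient `x * p + w * q` at `g_3` with `p, q ∈ ⟨x, w⟩`, then so has `f` at the
edges containing `3`; the triple `(e, i, j)` selects the edge and the variables. -/
theorem IsScarf.coord_mem_of_d (hX : X.IsScarf) {f : X.FreeModule k} (hf : f ∈ X.hpart k 2)
    {e : Fin 5} {i j : Fin 4} (h : e = 0 ∧ i = 3 ∧ j = 0 ∨ e = 1 ∧ i = 0 ∧ j = 3)
    {p : MvPolynomial (Fin 4) k} (hp : p ∈ outerIdeal k)
    (hd : killVars k {i} (X.coord k {3} (X.d k f)) = killVars k {i} (MvPolynomial.X j * p)) :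
    X.coord k {e, 3} f ∈ outerIdeal k := by
  have hface : ∀ e : Fin 5, IsScarfFace {e, 3} ∨ ¬ (e = 0 ∨ e = 1) := by decide
  have hW : IsScarfFace {e, 3} := (hface e).resolve_right (not_not.2 (h.imp And.left And.left))
  set s : k := (X.sign {e, 3} {3} : k)
  have hs0 : s ≠ 0 := by
    have := hX.isSimplicial.sign_ne_zero (k := k) (hX.mem_cells hW) (v := e) (by simp)
    have herase : ∀ e : Fin 5, e = 0 ∨ e = 1 → ({e, 3} : Finset (Fin 5)).erase e = {3} := by
      decide
    rwa [herase e (h.imp And.left And.left)] at this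
  -- lcm(xy, y²z²) / y²z² = x and lcm(zw, y²z²) / y²z² = w.
  have hexp : X.mdeg {e, 3} - X.mdeg {3} = Finsupp.single j 1 := by
    ext l
    rw [Finsupp.tsub_apply, hX.mdeg_apply, hX.mdeg_apply, Finsupp.single_apply]
    have key : ∀ (e : Fin 5) (i j l : Fin 4), e = 0 ∧ i = 3 ∧ j = 0 ∨ e = 1 ∧ i = 0 ∧ j = 3 →
      ((({e, 3} : Finset (Fin 5)).sup fun v => genExponent v l) -
        (({3} : Finset (Fin 5)).sup fun v => genExponent v l)) = if j = l then 1 else 0 := by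
      decide +kernel
    exact key e i j l h
  have hmono : MvPolynomial.monomial (X.mdeg {e, 3} - X.mdeg {3}) s =
      MvPolynomial.C s * MvPolynomial.X j := by
    rw [MvPolynomial.C_mul_X_eq_monomial, hexp]
  -- The only edges at 3 are {0,3} and {1,3}, entering with ± x and ± w; modulo the variable i only
  -- {e,3} is left.
  have h1 : X.coord k {3} (X.d k f) -
      X.coord k {e, 3} f * (MvPolynomial.C s * MvPolynomial.X j) ∈
      RingHom.ker (killVars k {i}) := by
    have := map_mem_of_hpart (X.coord k {3} ∘ₗ X.d k -
      MvPolynomial.monomial (X.mdeg {e, 3} - X.mdeg {3}) s • X.coord k {e, 3})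
      (RingHom.ker (killVars k {i})) hf ?_
    · rw [hmono] at this
      simpa [mul_comm] using this
    intro W hWc hr
    right
    have hWf := (hX.mem_cells_iff W).1 hWc
    rw [hX.rank_eq W hWc] at hr
    simp only [LinearMap.sub_apply, LinearMap.comp_apply, LinearMap.smul_apply, smul_eq_mul]
    by_cases hWe : W = {e, 3}
    · subst hWe
      rw [coord_cell_self hWc, hX.coord_d_edge hWf, mul_one, sub_self]
      exact Ideal.zero_mem _
    rw [coord_cell_of_ne (Ne.symm hWe), mul_zero, sub_zero]
    by_cases h3 : (3 : Fin 5) ∈ W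
    · rw [hX.coord_d_edge hWf, RingHom.mem_ker]
      refine killVars_monomial_eq_zero (Finset.mem_singleton_self i) ?_ _
      rw [Finsupp.tsub_apply, hX.mdeg_apply, hX.mdeg_apply, Finset.sup_singleton]
      have key : ∀ (e : Fin 5) (i j : Fin 4), e = 0 ∧ i = 3 ∧ j = 0 ∨ e = 1 ∧ i = 0 ∧ j = 3 →
        ∀ W : Finset (Fin 5), IsScarfFace W ∧ W.card = 2 ∧ W ≠ {e, 3} ∧ 3 ∈ W →
        (W.sup fun v => genExponent v i) - genExponent 3 i ≠ 0 := by decide +kernel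
      exact key e i j h W ⟨hWf, hr, hWe, h3⟩
    · rw [hX.coord_d_edge_eq_zero hWf h3]; exact Ideal.zero_mem _
  have hX0 : killVars k {i} (MvPolynomial.X j) = MvPolynomial.X j := by
    rw [killVars, MvPolynomial.aeval_X, if_neg]
    rw [Finset.mem_singleton]
    rcases h with ⟨_, rfl, rfl⟩ | ⟨_, rfl, rfl⟩ <;> decide
  have hC : ∀ t, killVars k t (MvPolynomial.C s) = MvPolynomial.C s :=
    fun t => (killVars k t).commutes s
  rw [RingHom.mem_ker, map_sub, hd, sub_eq_zero, map_mul, map_mul, map_mul, hX0, hC] at h1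
  -- The variable j is cancelled while only i is set to zero; setting both to zero at once would
  -- make the equation empty.
  have h2 : killVars k {i} p = MvPolynomial.C s * killVars k {i} (X.coord k {e, 3} f) :=
    mul_left_cancel₀ (MvPolynomial.X_ne_zero j) (h1.trans (by ring))
  have hsub : ({i} : Finset (Fin 4)) ⊆ {0, 3} := by
    rcases h with ⟨_, rfl, rfl⟩ | ⟨_, rfl, rfl⟩ <;> decide
  have h3 := congrArg (killVars k {0, 3}) h2
  rw [map_mul, hC, killVars_killVars hsub, killVars_killVars hsub, mem_outerIdeal.1 hp] at h3
  rw [mem_outerIdeal]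
  exact (mul_eq_zero.1 h3.symm).resolve_left (by simpa using hs0)

variable {mul : X.FreeModule k →ₗ[MvPolynomial (Fin 4) k] X.FreeModule k →ₗ[MvPolynomial (Fin 4) k]
  X.FreeModule k}

theorem IsScarf.two_mul_exponent_mem (hX : X.IsScarf) (u v : Fin 5) (c : k)
    (h : ({u, v} : Finset (Fin 5)).sup (fun v => genExponent v 0) <
        genExponent u 0 + genExponent v 0 ∨
      ({u, v} : Finset (Fin 5)).sup (fun v => genExponent v 3) <
        genExponent u 3 + genExponent v 3) :
    MvPolynomial.monomial (genVector u + genVector v - X.mdeg {u, v}) c ∈ outerIdeal k := by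
  refine monomial_mem_outerIdeal ?_ c
  rw [Finsupp.tsub_apply, Finsupp.tsub_apply, hX.mdeg_apply, hX.mdeg_apply, Finsupp.add_apply,
    Finsupp.add_apply, genVector_apply, genVector_apply, genVector_apply, genVector_apply]
  omega

/-- The product g_u * g_v is a nonzero multiple of g_uv, the module is torsion-free, and g_v * g_v =
0. -/
theorem IsGradedDGA.edge_mul_eq_zero (h : X.IsGradedDGA mul) (hX : X.IsScarf)
    {u v : Fin 5} (hu : u ≠ 3) (hv : v = 2 ∨ v = 4) (huv : u ≠ v) :
    mul (X.cell k {u, v}) (X.cell k {v}) = 0 := by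
  have hv' : v ≠ 3 := by rintro rfl; revert hv; decide
  obtain ⟨c, hc0, hc⟩ := h.exists_vertex_mul_vertex_eq hX hu hv' huv
  have h1 := h.assoc (X.cell k {u}) (X.cell k {v}) (X.cell k {v})
  rw [h.vertex_mul_self hX hv, map_zero, hc, map_smul, LinearMap.smul_apply] at h1
  exact (smul_eq_zero.1 h1).resolve_left (by simpa using hc0)

theorem IsGradedDGA.mul_edge_eq_zero (h : X.IsGradedDGA mul) (hX : X.IsScarf)
    {u v : Fin 5} (hu : u = 2 ∨ u = 4) (hv : v ≠ 3) (huv : u ≠ v) :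
    mul (X.cell k {u}) (X.cell k {u, v}) = 0 := by
  have hu' : u ≠ 3 := by rintro rfl; revert hu; decide
  obtain ⟨c, hc0, hc⟩ := h.exists_vertex_mul_vertex_eq hX hu' hv huv
  have h1 := h.assoc (X.cell k {u}) (X.cell k {u}) (X.cell k {v})
  rw [h.vertex_mul_self hX hu, map_zero, LinearMap.zero_apply, hc, map_smul] at h1
  exact (smul_eq_zero.1 h1.symm).resolve_left (by simpa using hc0)

/-- The edge is a scalar times g_u * g_1, and g_1 * g_4 is divisible by w, the common factor of zw
and w². -/
theorem IsGradedDGA.coord_edge_mul_mem (h : X.IsGradedDGA mul) (hX : X.IsScarf)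
    {u : Fin 5} (hu : u = 0 ∨ u = 2) (T : Finset (Fin 5)) :
    X.coord k T (mul (X.cell k {u, 1}) (X.cell k {4})) ∈ outerIdeal k := by
  have hne : ∀ u : Fin 5, u = 0 ∨ u = 2 → u ≠ 3 ∧ u ≠ 1 ∧
      ∀ j, genExponent u j = 0 ∨ genExponent 1 j = 0 := by decide
  obtain ⟨h3, h1, hd⟩ := hne u hu
  obtain ⟨c, hc⟩ := h.exists_edge_eq hX h3 (by decide : (1 : Fin 5) ≠ 3) h1 hd
  obtain ⟨b, -, hb⟩ := h.exists_vertex_mul_vertex_eq hX (by decide : (1 : Fin 5) ≠ 3)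
    (by decide : (4 : Fin 5) ≠ 3) (by decide)
  rw [hc, map_smul, LinearMap.smul_apply, h.assoc, hb, map_smul, map_smul, map_smul]
  exact Ideal.mul_mem_left _ _ (Ideal.mul_mem_right _ _
    (hX.two_mul_exponent_mem 1 4 b (by decide)))

/-- The edge is a scalar times g_0 * g_v, and g_2 * g_0 is divisible by x, the common factor of x²
and xy. -/
theorem IsGradedDGA.coord_mul_edge_mem (h : X.IsGradedDGA mul) (hX : X.IsScarf)
    {v : Fin 5} (hv : v = 1 ∨ v = 4) (T : Finset (Fin 5)) :
    X.coord k T (mul (X.cell k {2}) (X.cell k {0, v})) ∈ outerIdeal k := by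
  have hne : ∀ v : Fin 5, v = 1 ∨ v = 4 → v ≠ 3 ∧ 0 ≠ v ∧
      ∀ j, genExponent 0 j = 0 ∨ genExponent v j = 0 := by decide
  obtain ⟨h3, h0, hd⟩ := hne v hv
  obtain ⟨c, hc⟩ := h.exists_edge_eq hX (by decide : (0 : Fin 5) ≠ 3) h3 h0 hd
  obtain ⟨b, -, hb⟩ := h.exists_vertex_mul_vertex_eq hX (by decide : (2 : Fin 5) ≠ 3)
    (by decide : (0 : Fin 5) ≠ 3) (by decide)
  rw [hc, map_smul, ← h.assoc, hb, map_smul, map_smul, LinearMap.smul_apply, map_smul]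
  exact Ideal.mul_mem_left _ _ (Ideal.mul_mem_right _ _
    (hX.two_mul_exponent_mem 2 0 b (by decide)))

/-- The coefficient of `g_024` in `f * g_4` modulo `⟨x, w⟩`. -/
theorem IsGradedDGA.coord_mul_four (h : X.IsGradedDGA mul) (hX : X.IsScarf)
    {f : X.FreeModule k} (hf : f ∈ X.hpart k 2) (h03 : X.coord k {0, 3} f ∈ outerIdeal k)
    (h13 : X.coord k {1, 3} f ∈ outerIdeal k) :
    X.coord k {0, 2, 4} (mul f (X.cell k {4})) -
      X.coord k {0, 2, 4} (mul (X.cell k {0, 2}) (X.cell k {4})) * X.coord k {0, 2} f ∈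
      outerIdeal k := by
  refine map_mem_of_hpart (X.coord k {0, 2, 4} ∘ₗ mul.flip (X.cell k {4}) -
      X.coord k {0, 2, 4} (mul (X.cell k {0, 2}) (X.cell k {4})) • X.coord k {0, 2})
      (outerIdeal k) hf fun W hWc hr => ?_
  rw [hX.rank_eq W hWc] at hr
  simp only [LinearMap.sub_apply, LinearMap.comp_apply, LinearMap.smul_apply, smul_eq_mul,
    LinearMap.flip_apply]
  have hz : ∀ W : Finset (Fin 5), {0, 2} ≠ W →
      X.coord k {0, 2, 4} (mul (X.cell k W) (X.cell k {4})) ∈ outerIdeal k →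
      X.coord k {0, 2, 4} (mul (X.cell k W) (X.cell k {4})) -
      X.coord k {0, 2, 4} (mul (X.cell k {0, 2}) (X.cell k {4})) * X.coord k {0, 2} (X.cell k W) ∈
      outerIdeal k := by
    intro W hW hm
    rwa [coord_cell_of_ne hW, mul_zero, sub_zero]
  have h4 : ∀ u : Fin 5, u ≠ 3 → u ≠ 4 →
      X.coord k {0, 2, 4} (mul (X.cell k {u, 4}) (X.cell k {4})) ∈ outerIdeal k := by
    intro u hu hu4
    rw [h.edge_mul_eq_zero hX hu (Or.inr rfl) hu4, map_zero]
    exact Ideal.zero_mem _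
  rcases edge_cases ((hX.mem_cells_iff W).1 hWc) hr with
    rfl | rfl | rfl | rfl | rfl | rfl | rfl | rfl
  · exact Or.inr (hz _ (by decide) (h.coord_edge_mul_mem hX (Or.inl rfl) _))
  · rw [coord_cell_self hWc, mul_one, sub_self]
    exact Or.inr (Ideal.zero_mem _)
  · exact Or.inl h03
  · exact Or.inr (hz _ (by decide) (h4 0 (by decide) (by decide)))
  · refine Or.inr (hz _ (by decide) ?_)
    rw [show ({1, 2} : Finset (Fin 5)) = {2, 1} by decide]
    exact h.coord_edge_mul_mem hX (Or.inr rfl) _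
  · exact Or.inl h13
  · exact Or.inr (hz _ (by decide) (h4 1 (by decide) (by decide)))
  · exact Or.inr (hz _ (by decide) (h4 2 (by decide) (by decide)))

/-- The coefficient of `g_024` in `g_2 * f` modulo `⟨x, w⟩`. -/
theorem IsGradedDGA.coord_two_mul (h : X.IsGradedDGA mul) (hX : X.IsScarf)
    {f : X.FreeModule k} (hf : f ∈ X.hpart k 2) (h03 : X.coord k {0, 3} f ∈ outerIdeal k)
    (h13 : X.coord k {1, 3} f ∈ outerIdeal k) :
    X.coord k {0, 2, 4} (mul (X.cell k {2}) f) ∈ outerIdeal k := by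
  refine map_mem_of_hpart (X.coord k {0, 2, 4} ∘ₗ mul (X.cell k {2}))
      (outerIdeal k) hf fun W hWc hr => ?_
  rw [hX.rank_eq W hWc] at hr
  simp only [LinearMap.comp_apply]
  have h2 : ∀ u : Fin 5, u ≠ 3 → 2 ≠ u →
      X.coord k {0, 2, 4} (mul (X.cell k {2}) (X.cell k {2, u})) ∈ outerIdeal k := by
    intro u hu hu4
    rw [h.mul_edge_eq_zero hX (Or.inl rfl) hu hu4, map_zero]
    exact Ideal.zero_mem _
  rcases edge_cases ((hX.mem_cells_iff W).1 hWc) hr with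
    rfl | rfl | rfl | rfl | rfl | rfl | rfl | rfl
  · exact Or.inr (h.coord_mul_edge_mem hX (Or.inl rfl) _)
  · rw [show ({0, 2} : Finset (Fin 5)) = {2, 0} by decide]
    exact Or.inr (h2 0 (by decide) (by decide))
  · exact Or.inl h03
  · exact Or.inr (h.coord_mul_edge_mem hX (Or.inr rfl) _)
  · rw [show ({1, 2} : Finset (Fin 5)) = {2, 1} by decide]
    exact Or.inr (h2 1 (by decide) (by decide))
  · exact Or.inl h13
  -- Since g_1 * g_4 is only a multiple of w g_14, associativity does not reach g_14 itself. But g_2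
  -- * g_14 has multidegree x²zw², which the lcm x²yw² of {0,2,4} does not divide.
  · right
    rw [coord_eq_zero_of_mem_gpart _
      (h.vertex_mul_edge_mem hX (by decide : (2 : Fin 5) ≠ 3) hr (by decide))]
    · exact Ideal.zero_mem _
    · intro hle
      have := hle 1
      rw [hX.mdeg_apply, Finsupp.add_apply, hX.mdeg_apply] at this
      revert this; decide
  · exact Or.inr (h2 4 (by decide) (by decide))

/-- The face {0,2,4} is the only one with three vertices below x²y · w² = x²yw². If c were 0,
Leibniz would give w² g_02 = g_4 * ∂g_02, but the right side is supported on {0,4} and {2,4}. -/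
theorem IsGradedDGA.exists_coord_eq_C (h : X.IsGradedDGA mul) (hX : X.IsScarf) :
    ∃ c : k, c ≠ 0 ∧
      X.coord k {0, 2, 4} (mul (X.cell k {0, 2}) (X.cell k {4})) = MvPolynomial.C c := by
  have hcard : ({0, 2} : Finset (Fin 5)).card = 2 := by decide
  have hface : IsScarfFace {0, 2} := by decide
  have hcomm := h.comm 2 1 _ (hX.edge_mem_hpart (k := k) hcard) _ (hX.vertex_mem_hpart 4)
  rw [show ((-1 : ℤ) ^ (2 * 1)) = 1 by norm_num, one_smul] at hcomm
  have hmem := h.vertex_mul_edge_mem hX (by decide : (4 : Fin 5) ≠ 3) hcard (by decide)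
  have hα : genVector 4 + X.mdeg {0, 2} = X.mdeg {0, 2, 4} := by
    ext j
    rw [Finsupp.add_apply, hX.mdeg_apply, hX.mdeg_apply, genVector_apply]
    revert j; decide
  have key : ∀ W : Finset (Fin 5), IsScarfFace W → W.card = 3 →
      (∀ j, (W.sup fun v => genExponent v j) ≤
        ({0, 2, 4} : Finset (Fin 5)).sup fun v => genExponent v j) → W = {0, 2, 4} := by
    decide +kernel
  rw [hα] at hmem
  obtain ⟨c, hc⟩ := exists_eq_smul_cell_of_mem_gpart le_rfl (fun W hW hr hle => key W
    ((hX.mem_cells_iff W).1 hW) ((hX.rank_eq W hW).symm.trans hr) fun j => by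
      rw [← hX.mdeg_apply, ← hX.mdeg_apply]; exact hle j) hmem
  rw [hcomm, hc, map_smul, coord_cell_self (hX.mem_cells (by decide)), tsub_self, smul_eq_mul,
    mul_one]
  refine ⟨c, ?_, rfl⟩
  rintro rfl
  have hd := h.d_vertex_mul hX 4 (X.cell k {0, 2})
  rw [hc, map_zero, zero_smul, map_zero] at hd
  have h1 := congrArg (X.coord k {0, 2}) hd
  have h2 : X.coord k {0, 2} (mul (X.cell k {4}) (X.d k (X.cell k {0, 2}))) ∈
      (⊥ : Ideal (MvPolynomial (Fin 4) k)) := by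
    refine map_mem_of_hpart (X.coord k {0, 2} ∘ₗ mul (X.cell k {4})) ⊥ (i := 1)
      (mem_hpart_of_mem_gpart (d_mem_gpart (mem_hpart_iff.1 (hX.edge_mem_hpart hcard))))
      fun W hWc hr => ?_
    rw [hX.rank_eq W hWc] at hr
    obtain ⟨v, rfl⟩ := Finset.card_eq_one.1 hr
    by_cases hv : v ∈ ({0, 2} : Finset (Fin 5))
    · right
      have hv' : ∀ v : Fin 5, v ∈ ({0, 2} : Finset (Fin 5)) → v ≠ 3 ∧ 4 ≠ v ∧
        ({0, 2} : Finset (Fin 5)) ≠ {4, v} := by decide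
      obtain ⟨b, -, hb⟩ := h.exists_vertex_mul_vertex_eq hX (by decide : (4 : Fin 5) ≠ 3)
        (hv' v hv).1 (hv' v hv).2.1
      rw [LinearMap.comp_apply, hb, map_smul, coord_cell_of_ne (hv' v hv).2.2, smul_zero]
      exact Ideal.zero_mem _
    · left
      rw [hX.coord_d_edge_eq_zero hface hv]
      exact Ideal.zero_mem _
  rw [map_sub, Ideal.mem_bot.1 h2, map_smul, coord_cell_self (hX.mem_cells hface), map_zero] at h1
  simp [eq_comm (a := (0 : MvPolynomial (Fin 4) k))] at h1

theorem IsGradedDGA.coord_d_vertex_mul_vertex (h : X.IsGradedDGA mul) (hX : X.IsScarf)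
    {u v : Fin 5} (huv : u ≠ v) :
    X.coord k {v} (X.d k (mul (X.cell k {u}) (X.cell k {v}))) =
      MvPolynomial.monomial (genVector u) (1 : k) ∧
    X.coord k {u} (X.d k (mul (X.cell k {u}) (X.cell k {v}))) =
      - MvPolynomial.monomial (genVector v) (1 : k) := by
  have hc : ∀ v, X.coord k {v} (X.cell k {v}) = 1 := fun v =>
    coord_cell_self (hX.mem_cells (isScarfFace_singleton v))
  rw [h.d_vertex_mul_vertex hX]
  simp only [map_sub, map_smul, hc]
  rw [coord_cell_of_ne (by simpa using huv.symm), coord_cell_of_ne (by simpa using huv)]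
  simp

/-- The Scarf complex admits no graded DGA structure: `(g_2 * g_3) * g_4` and `g_2 * (g_3 * g_4)`
differ. -/
theorem IsScarf.not_isGradedDGA (hX : X.IsScarf) (h : X.IsGradedDGA mul) : False := by
  have hv := fun v => hX.vertex_mem_hpart (k := k) v
  have hA : mul (X.cell k {2}) (X.cell k {3}) ∈ X.hpart k 2 := h.mul_mem 1 1 _ (hv 2) _ (hv 3)
  have hC : mul (X.cell k {3}) (X.cell k {4}) ∈ X.hpart k 2 := h.mul_mem 1 1 _ (hv 3) _ (hv 4)
  have hx : MvPolynomial.monomial (genVector 2) (1 : k) = MvPolynomial.X 0 ^ 2 :=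
    monomial_genVector k 2
  have hw : MvPolynomial.monomial (genVector 4) (1 : k) = MvPolynomial.X 3 ^ 2 :=
    monomial_genVector k 4
  have hXm : ∀ i : Fin 4, i = 0 ∨ i = 3 → (MvPolynomial.X i : MvPolynomial (Fin 4) k) ∈
      outerIdeal k := by
    rintro i hi
    refine monomial_mem_outerIdeal ?_ 1
    rcases hi with rfl | rfl <;> simp
  have hkill : ∀ i : Fin 4, killVars k {i} (MvPolynomial.X i) = 0 := fun i => by
    simp [killVars]
  obtain ⟨hA3, hA2⟩ := h.coord_d_vertex_mul_vertex hX (by decide : (2 : Fin 5) ≠ 3)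
  obtain ⟨-, hC3⟩ := h.coord_d_vertex_mul_vertex hX (by decide : (3 : Fin 5) ≠ 4)
  rw [hx] at hA3
  rw [hw] at hC3
  -- At g_3, ∂A has x² = x · x, which vanishes modulo x, and ∂C has −w² = w · (−w), which vanishes
  -- modulo w.
  have hA03 := hX.coord_mem_of_d hA (Or.inl ⟨rfl, rfl, rfl⟩) (hXm 0 (Or.inl rfl))
    (by rw [hA3, sq])
  have hA13 := hX.coord_mem_of_d hA (Or.inr ⟨rfl, rfl, rfl⟩) (Ideal.zero_mem _)
    (by rw [hA3, sq, map_mul, hkill]; simp)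
  have hC03 := hX.coord_mem_of_d hC (Or.inl ⟨rfl, rfl, rfl⟩) (Ideal.zero_mem _)
    (by rw [hC3, sq, map_neg, map_mul, hkill]; simp)
  have hC13 := hX.coord_mem_of_d hC (Or.inr ⟨rfl, rfl, rfl⟩)
    (neg_mem (hXm 3 (Or.inr rfl))) (by rw [hC3, sq, mul_neg])
  obtain ⟨c, hc0, hc⟩ := h.exists_coord_eq_C hX
  -- Modulo ⟨x, w⟩, the coefficient of g_024 is c A_02 in A * g_4 and 0 in g_2 * C.
  have h1 := h.coord_mul_four hX hA hA03 hA13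
  rw [h.assoc, hc, ← neg_mem_iff, neg_sub] at h1
  have h2 := add_mem h1 (h.coord_two_mul hX hC hC03 hC13)
  rw [sub_add_cancel] at h2
  have h3 : X.coord k {0, 2} (mul (X.cell k {2}) (X.cell k {3})) ∈ outerIdeal k := by
    have := Ideal.mul_mem_left _ (MvPolynomial.C c⁻¹) h2
    rwa [← mul_assoc, ← map_mul, inv_mul_cancel₀ hc0, map_one, one_mul] at this
  -- The edges at 2 are {0,2}, {1,2}, {2,4}, with boundary coefficients ± y, ± zw, ± w² at g_2; the
  -- last two lie in ⟨x, w⟩.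
  have h4 : X.coord k {2} (X.d k (mul (X.cell k {2}) (X.cell k {3}))) ∈ outerIdeal k := by
    refine map_mem_of_hpart (X.coord k {2} ∘ₗ X.d k) (outerIdeal k) hA fun W hWc hr => ?_
    have hWf := (hX.mem_cells_iff W).1 hWc
    rw [hX.rank_eq W hWc] at hr
    by_cases hW : W = {0, 2}
    · subst hW; exact Or.inl h3
    right
    rw [LinearMap.comp_apply]
    by_cases hm : (2 : Fin 5) ∈ W
    · rw [hX.coord_d_edge hWf]
      refine hX.monomial_mdeg_sub_mem W {2} _ ?_
      clear * - hWf hr hW hm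
      revert W; decide +kernel
    · rw [hX.coord_d_edge_eq_zero hWf hm]; exact Ideal.zero_mem _
  rw [hA2, neg_mem_iff] at h4
  exact monomial_notMem_outerIdeal ⟨rfl, rfl⟩ one_ne_zero h4

theorem IsScarf.not_admitsDGAStructure (hX : X.IsScarf) (k : Type*) [Field k] :
    ¬ X.AdmitsDGAStructure k := by
  rintro ⟨mul, h, hg⟩
  exact hX.not_isGradedDGA { toIsDGAStructure := h, homogeneous := hg }

end LabelledCellComplex

/-! ### The hull complex. -/

section Hull

/-- The vertices of the polyhedron `P_t` of `genIdeal`. -/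
noncomputable def hullVertex (t : ℝ) (v : Fin 5) : Fin 4 → ℝ := powPoint t (genVector v)

theorem hullVertex_apply (t : ℝ) (v : Fin 5) (i : Fin 4) :
    hullVertex t v i = t ^ genExponent v i := rfl

/-- This makes the dimension of the hull of the vertices in W equal to |W| − 1, so the hull complex
is simplicial. -/
theorem affineIndependent_hullVertex {t : ℝ} (ht : 1 < t) :
    AffineIndependent ℝ (hullVertex t) := by
  rw [affineIndependent_iff_of_fintype]
  intro w hw h
  rw [Finset.weightedVSub_eq_linear_combination _ hw] at h
  have h0 := congrFun h 0
  have h1 := congrFun h 1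
  have h2 := congrFun h 2
  have h3 := congrFun h 3
  simp [Fin.sum_univ_succ, hullVertex_apply, genExponent] at hw h0 h1 h2 h3
  have ht1 : t - 1 ≠ 0 := by linarith
  -- Subtracting the vanishing total weight turns t ^ a into t ^ a − 1, from which t − 1 is
  -- cancelled.
  have e0 : w 0 + (t + 1) * w 2 = 0 := mul_left_cancel₀ ht1 (by linear_combination h0 - hw)
  have e1 : w 0 + (t + 1) * w 3 = 0 := mul_left_cancel₀ ht1 (by linear_combination h1 - hw)
  have e2 : w 1 + (t + 1) * w 3 = 0 := mul_left_cancel₀ ht1 (by linear_combination h2 - hw)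
  have e3 : w 1 + (t + 1) * w 4 = 0 := mul_left_cancel₀ ht1 (by linear_combination h3 - hw)
  have ht2 : t + 1 ≠ 0 := by linarith
  have e23 : w 2 = w 3 := mul_left_cancel₀ ht2 (by linear_combination e0 - e1)
  have e43 : w 4 = w 3 := mul_left_cancel₀ ht2 (by linear_combination e3 - e2)
  have e : w 3 = 0 := by
    -- With w_0 = w_1 = −(t + 1) w_3 and w_2 = w_4 = w_3 the total weight is (1 − 2t) w_3.
    have ht3 : 1 - 2 * t ≠ 0 := by linarith
    refine mul_left_cancel₀ ht3 ?_
    linear_combination hw - e1 - e2 - e23 - e43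
  rw [e, mul_zero, add_zero] at e1 e2
  intro i
  fin_cases i
  exacts [e1, e2, e23.trans e, e, e43.trans e]

theorem finrank_vectorSpan_hullVertex {t : ℝ} (ht : 1 < t) {W : Finset (Fin 5)} (hW : W ≠ ∅) :
    Module.finrank ℝ (vectorSpan ℝ ((fun v => powPoint t (genVector v)) '' (W : Set (Fin 5)))) + 1 =
      W.card := by
  classical
  obtain ⟨n, hn⟩ := Nat.exists_eq_succ_of_ne_zero (mt Finset.card_eq_zero.1 hW)
  have := (affineIndependent_hullVertex ht).finrank_vectorSpan_image_finset hn
  rw [Finset.coe_image] at this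
  rw [hn, ← this]
  rfl

theorem powPoint_mem_hullPolyhedron {k : Type*} [Field k] {t : ℝ} {a : Fin 4 →₀ ℕ} {v : Fin 5}
    (h : genVector v ≤ a) : powPoint t a ∈ hullPolyhedron (genIdeal k) t :=
  subset_convexHull ℝ _ ⟨a, monomial_mem_genIdeal.2 ⟨v, h⟩, rfl⟩

/-- A functional which attains its maximum on `P_t` exactly on a bounded face is negative on the
coordinate directions. -/
theorem apply_single_neg_of_isBounded {k : Type*} [Field k] {t : ℝ} (ht : 1 < t)
    {l : StrongDual ℝ (Fin 4 → ℝ)} {v : Fin 5}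
    (hv : ∀ y ∈ hullPolyhedron (genIdeal k) t, l y ≤ l (hullVertex t v))
    (hb : Bornology.IsBounded {x ∈ hullPolyhedron (genIdeal k) t |
      ∀ y ∈ hullPolyhedron (genIdeal k) t, l y ≤ l x}) (i : Fin 4) :
    l (Pi.single i 1) < 0 := by
  by_contra! h
  obtain ⟨C, hC⟩ := hb.exists_norm_le
  obtain ⟨n, hn⟩ := pow_unbounded_of_one_lt C ht
  -- Multiplying the generator by the n-th power of the variable i moves the vertex along the axis i
  -- inside P_t. If l does not decrease, the new point lies in the face, with a coordinate exceeding
  -- C.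
  set a : Fin 4 →₀ ℕ := genVector v + Finsupp.single i n with ha
  have hle : genVector v ≤ a := le_self_add
  have hpt : powPoint t a = hullVertex t v +
      (t ^ (genExponent v i + n) - t ^ genExponent v i) • Pi.single i 1 := by
    ext j
    rw [powPoint, ha, Finsupp.add_apply, genVector_apply, Pi.add_apply, hullVertex_apply,
      Pi.smul_apply]
    by_cases hj : j = i
    · subst hj; simp
    · simp [hj]
  have hge : l (hullVertex t v) ≤ l (powPoint t a) := by
    rw [hpt, map_add, map_smul, le_add_iff_nonneg_right]
    exact mul_nonneg (sub_nonneg.2 (pow_le_pow_right₀ ht.le (Nat.le_add_right _ _))) h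
  have hmem := hC _ ⟨powPoint_mem_hullPolyhedron hle, fun y hy => (hv y hy).trans hge⟩
  have h1 := (norm_le_pi_norm (powPoint t a) i).trans hmem
  have h2 : powPoint t a i = t ^ (genExponent v i + n) := by
    rw [powPoint, ha, Finsupp.add_apply, genVector_apply, Finsupp.single_eq_same]
  have h3 : t ^ n ≤ t ^ (genExponent v i + n) :=
    pow_le_pow_right₀ ht.le (Nat.le_add_left _ _)
  rw [h2] at h1
  linarith [le_abs_self (t ^ (genExponent v i + n)), Real.norm_eq_abs (t ^ (genExponent v i + n))]

theorem apply_eq_sum_single (l : StrongDual ℝ (Fin 4 → ℝ)) (x : Fin 4 → ℝ) :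
    l x = x 0 * l (Pi.single 0 1) + x 1 * l (Pi.single 1 1) + x 2 * l (Pi.single 2 1) +
      x 3 * l (Pi.single 3 1) := by
  conv_lhs => rw [pi_eq_sum_univ' x]
  rw [map_sum, Fin.sum_univ_four]
  simp only [map_smul, smul_eq_mul, Pi.single]

/-- Twice the vertex of xy falls short of the sum of the vertices of x² and y²z² by ((t−1)², (t−1)²,
t²−1, 0), so a functional negative on the axes is larger at xy than at one of the two. The pair
y²z², w² is treated alike with zw. -/
theorem isScarfFace_of_isExposed {k : Type*} [Field k] {t : ℝ} (ht : 1 < t) {W : Finset (Fin 5)}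
    {F : Set (Fin 4 → ℝ)} (hF : IsExposed ℝ (hullPolyhedron (genIdeal k) t) F)
    (hne : F.Nonempty) (hb : Bornology.IsBounded F) (hW : ∀ v, v ∈ W ↔ hullVertex t v ∈ F) :
    IsScarfFace W := by
  obtain ⟨l, rfl⟩ := hF hne
  have hP : ∀ v, hullVertex t v ∈ hullPolyhedron (genIdeal k) t := fun v =>
    powPoint_mem_hullPolyhedron le_rfl
  have hmax : ∀ v ∈ W, ∀ u, l (hullVertex t u) ≤ l (hullVertex t v) := fun v hv u =>
    ((hW v).1 hv).2 _ (hP u)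
  have hneg : ∀ v ∈ W, ∀ i, l (Pi.single i 1) < 0 := fun v hv =>
    apply_single_neg_of_isBounded ht ((hW v).1 hv).2 hb
  constructor
  · intro h
    have h2 : (2 : Fin 5) ∈ W := h (by simp)
    have h3 : (3 : Fin 5) ∈ W := h (by simp)
    have e2 := hmax 2 h2 0
    have e3 := hmax 3 h3 0
    have n0 := hneg 2 h2 0
    have n1 := hneg 2 h2 1
    have n2 := hneg 2 h2 2
    rw [apply_eq_sum_single l, apply_eq_sum_single l (hullVertex t _)] at e2 e3
    simp [hullVertex_apply, genExponent] at e2 e3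
    have hs : 0 < (t - 1) ^ 2 := pow_pos (by linarith) 2
    have hs' : 0 < t ^ 2 - 1 := by nlinarith
    nlinarith [mul_neg_of_pos_of_neg hs n0, mul_neg_of_pos_of_neg hs n1,
      mul_neg_of_pos_of_neg hs' n2]
  · intro h
    have h3 : (3 : Fin 5) ∈ W := h (by simp)
    have h4 : (4 : Fin 5) ∈ W := h (by simp)
    have e3 := hmax 3 h3 1
    have e4 := hmax 4 h4 1
    have n1 := hneg 3 h3 1
    have n2 := hneg 3 h3 2
    have n3 := hneg 3 h3 3
    rw [apply_eq_sum_single l, apply_eq_sum_single l (hullVertex t _)] at e3 e4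
    simp [hullVertex_apply, genExponent] at e3 e4
    have hs : 0 < (t - 1) ^ 2 := pow_pos (by linarith) 2
    have hs' : 0 < t ^ 2 - 1 := by nlinarith
    nlinarith [mul_neg_of_pos_of_neg hs n2, mul_neg_of_pos_of_neg hs n3,
      mul_neg_of_pos_of_neg hs' n1]

/-- For every face there is a positive functional whose minimum over the vertices of `P_t` is
attained exactly at the vertices of the face. -/
theorem exists_supporting_functional {t : ℝ} (ht : 120 < t) {W : Finset (Fin 5)}
    (hW : IsScarfFace W) : ∃ (c : Fin 4 → ℝ) (b : ℝ), (∀ i, 0 < c i) ∧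
      ∀ v, b ≤ ∑ i, c i * hullVertex t v i ∧ (∑ i, c i * hullVertex t v i = b ↔ v ∈ W) := by
  set u : Fin 5 → ℝ := fun v => if v ∈ W then 1 else 2 with hu
  have hu1 : ∀ v, 1 ≤ u v := fun v => by simp only [hu]; split_ifs <;> norm_num
  have hu2 : ∀ v, u v ≤ 2 := fun v => by simp only [hu]; split_ifs <;> norm_num
  have hu3 : ∀ v, u v = 1 ↔ v ∈ W := fun v => by simp only [hu]; split_ifs with h <;> simp [h]
  have ht1 : 0 < t + 1 := by linarith
  have ht2 : 0 < t - 1 := by linarith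
  have hsmall : ∀ v, u v / (t + 1) ≤ 1 / 2 := fun v => by
    rw [div_le_iff₀ ht1]; linarith [hu2 v]
  have hpos : ∀ v, 0 < u v / (t + 1) := fun v => div_pos (by linarith [hu1 v]) ht1
  have hcancel : ∀ v, (t + 1) * (u v / (t + 1)) = u v := fun v => mul_div_cancel₀ _ ht1.ne'
  -- The normalized heights are r_0 = c_0 + c_1, r_1 = c_2 + c_3, r_2 = (t+1) c_0, r_3 = (t+1)(c_1 +
  -- c_2), r_4 = (t+1) c_3.
  suffices h : ∃ (c : Fin 4 → ℝ) (r : Fin 5 → ℝ), (∀ i, 0 < c i) ∧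
      (∀ v, ∑ i, c i * hullVertex t v i = (∑ i, c i) + (t - 1) * r v) ∧
      (∀ v, 1 ≤ r v) ∧ ∀ v, r v = 1 ↔ v ∈ W by
    obtain ⟨c, r, hc, hr, hr1, hr2⟩ := h
    refine ⟨c, (∑ i, c i) + (t - 1) * 1, hc, fun v => ⟨?_, ?_⟩⟩
    · rw [hr]
      exact add_le_add_right (mul_le_mul_of_nonneg_left (hr1 v) ht2.le) _
    · rw [hr, add_right_inj, mul_right_inj' ht2.ne', hr2]
  by_cases h3 : (3 : Fin 5) ∈ W
  · have h2 : (2 : Fin 5) ∉ W := fun h => hW.1 (by simp [Finset.insert_subset_iff, h, h3])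
    have h4 : (4 : Fin 5) ∉ W := fun h => hW.2 (by simp [Finset.insert_subset_iff, h, h3])
    have hu33 := (hu3 3).2 h3
    -- Here c solves r = u at 0, 1, 3, with c_1 = c_2; the heights at 2 and 4, both outside W, then
    -- exceed 1.
    refine ⟨![u 0 - u 3 / (t + 1) / 2, u 3 / (t + 1) / 2, u 3 / (t + 1) / 2,
      u 1 - u 3 / (t + 1) / 2],
      ![u 0, u 1, (t + 1) * u 0 - u 3 / 2, u 3, (t + 1) * u 1 - u 3 / 2], ?_, ?_, ?_, ?_⟩
    · simp only [Fin.forall_fin_succ]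
      simp
      refine ⟨?_, ?_, ?_⟩ <;> linarith [hu1 0, hu1 1, hsmall 3, hpos 3]
    · simp only [Fin.forall_fin_succ]
      simp [Fin.sum_univ_four, hullVertex_apply, genExponent]
      have := hcancel 3
      refine ⟨?_, ?_, ?_, ?_, ?_⟩
      · ring
      · ring
      · linear_combination -(t - 1) / 2 * this
      · linear_combination (t - 1) * this
      · linear_combination -(t - 1) / 2 * this
    · simp only [Fin.forall_fin_succ]
      simp
      refine ⟨hu1 0, hu1 1, ?_, hu1 3, ?_⟩ <;> nlinarith [hu1 0, hu1 1]
    · simp only [Fin.forall_fin_succ]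
      simp
      refine ⟨hu3 0, hu3 1, ?_, hu3 3, ?_⟩
      · refine iff_of_false (ne_of_gt ?_) h2
        nlinarith [hu1 0]
      · refine iff_of_false (ne_of_gt ?_) h4
        nlinarith [hu1 1]
  -- Here c solves r = u at 0, 1, 2, 4; the remaining height is at least 2(t + 1) − 4 > 1, and 3 is
  -- outside W.
  · refine ⟨![u 2 / (t + 1), u 0 - u 2 / (t + 1), u 1 - u 4 / (t + 1), u 4 / (t + 1)],
      ![u 0, u 1, u 2, (t + 1) * (u 0 + u 1) - u 2 - u 4, u 4], ?_, ?_, ?_, ?_⟩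
    · simp only [Fin.forall_fin_succ]
      simp
      have := hpos 2
      have := hpos 4
      refine ⟨?_, ?_, ?_, ?_⟩ <;> linarith [hu1 0, hu1 1, hsmall 2, hsmall 4]
    · simp only [Fin.forall_fin_succ]
      simp [Fin.sum_univ_four, hullVertex_apply, genExponent]
      have h2 := hcancel 2
      have h4 := hcancel 4
      refine ⟨?_, ?_, ?_, ?_, ?_⟩
      · ring
      · ring
      · linear_combination (t - 1) * h2
      · linear_combination -(t - 1) * h2 - (t - 1) * h4
      · linear_combination (t - 1) * h4
    · simp only [Fin.forall_fin_succ]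
      simp
      refine ⟨hu1 0, hu1 1, hu1 2, ?_, hu1 4⟩
      nlinarith [hu1 0, hu1 1, hu2 2, hu2 4]
    · simp only [Fin.forall_fin_succ]
      simp
      refine ⟨hu3 0, hu3 1, hu3 2, ?_, hu3 4⟩
      refine iff_of_false (ne_of_gt ?_) h3
      nlinarith [hu1 0, hu1 1, hu2 2, hu2 4]

/-- The face is where a positive functional L attains its minimum b on P_t. As P_t lies in the
nonnegative orthant, its points satisfy x_i ≤ b / c_i there. `IsExposed` asks for a maximum, hence
−L. -/
theorem exists_isExposed_of_isScarfFace {k : Type*} [Field k] {t : ℝ} (ht : 120 < t)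
    {W : Finset (Fin 5)} (hW : IsScarfFace W) (hne : W.Nonempty) :
    ∃ F : Set (Fin 4 → ℝ), IsExposed ℝ (hullPolyhedron (genIdeal k) t) F ∧ F.Nonempty ∧
      Bornology.IsBounded F ∧ ∀ v, v ∈ W ↔ hullVertex t v ∈ F := by
  obtain ⟨c, b, hc, hcb⟩ := exists_supporting_functional ht hW
  obtain ⟨v₀, hv₀⟩ := hne
  set L : StrongDual ℝ (Fin 4 → ℝ) := ∑ i, c i • ContinuousLinearMap.proj i with hL
  have hLx : ∀ x, L x = ∑ i, c i * x i := fun x => by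
    simp [hL]
  simp only [← hLx] at hcb
  have hP : ∀ v, hullVertex t v ∈ hullPolyhedron (genIdeal k) t := fun v =>
    powPoint_mem_hullPolyhedron le_rfl
  have hlow : ∀ x ∈ hullPolyhedron (genIdeal k) t, b ≤ L x := by
    refine convexHull_min ?_ (convex_halfSpace_ge L.toLinearMap.isLinear b)
    rintro _ ⟨a, ha, rfl⟩
    obtain ⟨v, hv⟩ := monomial_mem_genIdeal.1 ha
    refine (hcb v).1.trans ?_
    rw [hLx, hLx]
    exact Finset.sum_le_sum fun i _ => mul_le_mul_of_nonneg_left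
      (pow_le_pow_right₀ (by linarith) (hv i)) (hc i).le
  have hnonneg : ∀ x ∈ hullPolyhedron (genIdeal k) t, 0 ≤ x := by
    refine convexHull_min ?_ (convex_Ici (0 : Fin 4 → ℝ))
    rintro _ ⟨a, _, rfl⟩ i
    exact pow_nonneg (by linarith) _
  have hmem : ∀ v, v ∈ W ↔
      hullVertex t v ∈ {x ∈ hullPolyhedron (genIdeal k) t | L x = b} := fun v => by
    rw [← (hcb v).2]
    exact ⟨fun h => ⟨hP v, h⟩, fun h => h.2⟩
  refine ⟨{x ∈ hullPolyhedron (genIdeal k) t | L x = b}, fun _ => ⟨-L, ?_⟩,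
    ⟨_, (hmem v₀).1 hv₀⟩, ?_, hmem⟩
  · ext x
    refine and_congr_right fun hx => ⟨fun h y hy => ?_, fun h => ?_⟩
    · rw [neg_apply, neg_apply, h, neg_le_neg_iff]
      exact hlow y hy
    · have h1 := h _ (hP v₀)
      rw [neg_apply, neg_apply, (hcb v₀).2.2 hv₀,
        neg_le_neg_iff] at h1
      exact le_antisymm h1 (hlow x hx)
  · refine (Metric.isBounded_Icc (0 : Fin 4 → ℝ) fun i => b / c i).subset ?_
    rintro x ⟨hx, hxb⟩
    have h0 := hnonneg x hx
    refine ⟨h0, fun i => ?_⟩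
    rw [le_div_iff₀ (hc i), ← hxb, hLx, mul_comm]
    exact Finset.single_le_sum (f := fun i => c i * x i)
      (fun j _ => mul_nonneg (hc j).le (h0 j)) (Finset.mem_univ i)

theorem hull_cells_iff {k : Type*} [Field k] {t : ℝ} (ht : 120 < t) (W : Finset (Fin 5)) :
    (W = ∅ ∨ ∃ F : Set (Fin 4 → ℝ), IsExposed ℝ (hullPolyhedron (genIdeal k) t) F ∧ F.Nonempty ∧
      Bornology.IsBounded F ∧ ∀ v, v ∈ W ↔ powPoint t (genVector v) ∈ F) ↔ IsScarfFace W := by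
  constructor
  · rintro (rfl | ⟨F, hF, hne, hb, hW⟩)
    · decide
    · exact isScarfFace_of_isExposed (by linarith) hF hne hb hW
  · intro h
    rcases W.eq_empty_or_nonempty with hW | hW
    · exact Or.inl hW
    · exact Or.inr (exists_isExposed_of_isScarfFace ht h hW)

namespace LabelledCellComplex

variable {X : LabelledCellComplex (Fin 4) (Fin 5)} {k : Type*} [Field k]

theorem IsHullComplex.isScarf {t : ℝ} (ht : 120 < t)
    (h : X.IsHullComplex (genIdeal k) genVector t) : X.IsScarf where
  mem_cells_iff W := (h.mem_cells_iff W).trans (hull_cells_iff ht W)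
  rank_eq W hW := by
    by_cases hne : W = ∅
    · rw [(X.rank_eq_zero_iff W hW).2 hne, hne, Finset.card_empty]
    · rw [h.rank_eq W hW hne, finrank_vectorSpan_hullVertex (by linarith) hne]
  label_eq := h.label_eq

theorem IsScarf.isHullComplex {t : ℝ} (ht : 120 < t) (hX : X.IsScarf) :
    X.IsHullComplex (genIdeal k) genVector t where
  lists := listsMinimalGenerators_genIdeal k
  label_eq := hX.label_eq
  mem_cells_iff W := (hX.mem_cells_iff W).trans (hull_cells_iff ht W).symm
  rank_eq W hW hne := by
    rw [hX.rank_eq W hW, finrank_vectorSpan_hullVertex (by linarith) hne]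

end LabelledCellComplex

end Hull

/-! ### The three resolutions. -/

theorem isScarf_lyubeznikComplex :
    ((lyubeznikComplex genVector).toLabelledCellComplex genVector).IsScarf where
  mem_cells_iff W := by
    change W = ∅ ∨ W ∈ (lyubeznikComplex genVector).faces ↔ _
    rw [mem_lyubeznikComplex_iff]
    rcases W.eq_empty_or_nonempty with rfl | h
    · exact iff_of_true (Or.inl rfl) (by decide)
    · simp [h, h.ne_empty]
  rank_eq _ _ := rfl
  label_eq := rfl

/-- Variables `x, y, z, w` are `X 0, X 1, X 2, X 3`. -/
theorem corollary5p3 (k : Type*) [Field k] (I : Ideal (MvPolynomial (Fin 4) k))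
    (hI : I = Ideal.span {MvPolynomial.X 0 ^ 2, MvPolynomial.X 0 * MvPolynomial.X 1,
      MvPolynomial.X 1 ^ 2 * MvPolynomial.X 2 ^ 2, MvPolynomial.X 2 * MvPolynomial.X 3,
      MvPolynomial.X 3 ^ 2})
    (m : Fin 5 → Fin 4 →₀ ℕ)
    (hm : ∀ i, MvPolynomial.monomial (m i) (1 : k) =
      ![MvPolynomial.X 0 * MvPolynomial.X 1, MvPolynomial.X 2 * MvPolynomial.X 3,
        MvPolynomial.X 0 ^ 2, MvPolynomial.X 1 ^ 2 * MvPolynomial.X 2 ^ 2,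
        MvPolynomial.X 3 ^ 2] i) :
    IsMonomialIdeal I ∧ ListsMinimalGenerators I m ∧
    -- the hull resolution
    (∀ t : ℝ, ((4 + 1).factorial : ℝ) < t →
      (∃ X : LabelledCellComplex (Fin 4) (Fin 5), X.IsHullComplex I m t) ∧
      ∀ X : LabelledCellComplex (Fin 4) (Fin 5), X.IsHullComplex I m t →
        ¬ X.AdmitsDGAStructure k) ∧
    -- the Lyubeznik resolution
    ¬ ((lyubeznikComplex m).toLabelledCellComplex m).AdmitsDGAStructure k ∧
    -- the minimal free resolution, supported on a simplicial complex
    ∃ Δ : AbstractSimplicialComplex (Fin 5),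
      (Δ.toPreAbstractSimplicialComplex.toLabelledCellComplex m).IsMinimalFreeResolution I ∧
      ¬ (Δ.toPreAbstractSimplicialComplex.toLabelledCellComplex m).AdmitsDGAStructure k := by
  obtain rfl := eq_genVector hm
  obtain rfl := hI.trans (span_eq_genIdeal k)
  have hL := isScarf_lyubeznikComplex
  refine ⟨isMonomialIdeal_genIdeal k, listsMinimalGenerators_genIdeal k, fun t ht => ?_,
    hL.not_admitsDGAStructure k, ⟨lyubeznikComplex genVector, fun v => ?_⟩,
    hL.isMinimalFreeResolution k, hL.not_admitsDGAStructure k⟩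
  · have ht' : (120 : ℝ) < t := lt_of_eq_of_lt (by norm_num [Nat.factorial]) ht
    -- The Lyubeznik complex, with its simplicial signs, witnesses that incidence functions exist on
    -- the hull complex.
    exact ⟨⟨_, hL.isHullComplex ht'⟩, fun X hX => (hX.isScarf ht').not_admitsDGAStructure k⟩
  · exact (mem_lyubeznikComplex_iff _).2 ⟨Finset.singleton_nonempty v, LabelledCellComplex.isScarfFace_singleton v⟩
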